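/- Let $n,m,D\ge 0$ be integers, $A\in\mathbb{R}^{n\times n}$ invertible, and $B_\tau,C_\tau\in\mathbb{R}^{n\times m}$ for $0\le\tau\le D$. Consider the multi-delay stochastic system $$x_{t+1}=Ax_t+\sum_{\tau=0}^{D}\left(B_\tau+\omega_t^\tau C_\tau\right)u_{t-\tau},\qquad t\ge 0,$$ with deterministic initial values $x_0,u_{-1},\dots,u_{-D}$. The noise vectors $\omega_t=(\omega_t^0,\dots,\omega_t^D)'$, $t\ge0$, are independent; for each $\tau$ the real random variables $\omega_t^\tau$, $t\ge 0$, are identically distributed with ${\bf E}(\omega_t^\tau)=0$ and ${\bf E}\left((\omega_t^\tau)^2\right)=\sigma_\tau^2<\infty$; and ${\bf E}(\omega_t^\tau\omega_t^\rho)=0$ for $\tau\ne\rho$. Let $\mathcal F_{t-1}=\sigma(\omega_0,\dots,\omega_{t-1})$. The system is called (asymptotically mean-square) stabilizable if there are gain matrices $K_0\in\mathbb{R}^{m\times n}$ and $K_1,\dots,K_D\in\mathbb{R}^{m\times m}$ such that, for all initial values, the feedback control $u_t=K_0x_t+\sum_{\tau=1}^{D}K_\tau u_{t-\tau}$ ($t\ge0$)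 is $\mathcal F_{t-1}$-measurable and satisfies $\sum_{t=0}^\infty{\bf E}(u_t'u_t)<\infty$, and the closed-loop state satisfies $\lim_{t\to\infty}{\bf E}(x_t'x_t)=0$. Put $L=\sum_{j=0}^{D}A^{D-j}B_j$. Then the system is stabilizable if and only if there exist matrices $Y\in\mathbb{R}^{m\times n}$ and $S\in\mathbb{R}^{n\times n}$, $S<0$ (symmetric negative definite), such that $$\begin{bmatrix} S & * & * & \cdots & *\\ AS+LY & S & * & \cdots & *\\ \sigma_0A^DC_0Y & 0 & S & \cdots & *\\ \vdots & \vdots & \vdots & \ddots & \vdots\\ \sigma_DA^DC_DY & 0 & 0 & \cdots & S\end{bmatrix}<0,$$ where $*$ denotes the transposes of the blocks below the diagonal. Moreover, for $P>0$ and $K\in\mathbb{R}^{m\times n}$, the matrices $Y=KP^{-1}$ and $S=-P^{-1}$ satisfy this matrix inequality if and only if $$P>(A-LK)'P(A-LK)+\sum_{\tau=0}^{D}\sigma_\tau^2K'C_\tau'(A')^DPA^DC_\tau K .$$ -/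

import Mathlib

open MeasureTheory ProbabilityTheory Filter Topology
open scoped Matrix

namespace MultiDelay

variable {n m D : ℕ} {Ω : Type*}

/-- Assumptions on the noise `ω t τ` (time `t`, channel `τ = 0, …, D`): the vectors
`ω_t = (ω_t^0, …, ω_t^D)` are independent over time, every channel is identically distributed over
time, with finite second moments, `E ω_t^τ = 0`, `E (ω_t^τ)² = σ_τ²`, and different channels are
uncorrelated. (For different times `E (ω_t^τ ω_s^ρ) = 0` follows from independence.) -/
structure IsNoise [MeasurableSpace Ω] (μ : Measure Ω) (ω : ℕ → Fin (D + 1) → Ω → ℝ)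
    (σ : Fin (D + 1) → ℝ) : Prop where
  measurable : ∀ t τ, Measurable (ω t τ)
  indep : iIndepFun (fun (t : ℕ) (θ : Ω) (τ : Fin (D + 1)) => ω t τ θ) μ
  identDistrib : ∀ t τ, IdentDistrib (ω t τ) (ω 0 τ) μ μ
  memLp : ∀ t τ, MemLp (ω t τ) 2 μ
  mean : ∀ t τ, ∫ θ, ω t τ θ ∂μ = 0
  variance : ∀ t τ, ∫ θ, ω t τ θ ^ 2 ∂μ = σ τ ^ 2
  uncorrelated : ∀ t τ ρ, τ ≠ ρ → ∫ θ, ω t τ θ * ω t ρ θ ∂μ = 0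

/-- The σ-algebra `F_{t-1}` generated by `ω_0, …, ω_{t-1}` (trivial for `t = 0`). -/
abbrev past (ω : ℕ → Fin (D + 1) → Ω → ℝ) (t : ℕ) : MeasurableSpace Ω :=
  ⨆ s : ℕ, ⨆ _ : s < t,
    MeasurableSpace.comap (fun (θ : Ω) (τ : Fin (D + 1)) => ω s τ θ) inferInstance

/-- The state equation `x_{t+1} = A x_t + ∑_{τ=0}^D (B_τ + ω_t^τ C_τ) u_{t-τ}`, `t ≥ 0`. Controls
are indexed by `ℤ`; only the times `t ≥ -D` occur. -/
def IsSolution (A : Matrix (Fin n) (Fin n) ℝ) (B C : Fin (D + 1) → Matrix (Fin n) (Fin m) ℝ)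
    (ω : ℕ → Fin (D + 1) → Ω → ℝ) (x : ℕ → Ω → Fin n → ℝ) (u : ℤ → Ω → Fin m → ℝ) : Prop :=
  ∀ (t : ℕ) (θ : Ω), x (t + 1) θ = A *ᵥ x t θ +
    ∑ τ : Fin (D + 1), (B τ + ω t τ θ • C τ) *ᵥ u ((t : ℤ) - ((τ : ℕ) : ℤ)) θ

/-- `u` is an admissible control with gains `K_0` and `K_1, …, K_D` (`K_τ` is `K ⟨τ - 1, _⟩`):
`u_t = K_0 x_t + ∑_{τ=1}^D K_τ u_{t-τ}` for `t ≥ 0`, `u_t` is `F_{t-1}`-measurable, and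
`∑_{t ≥ 0} E (u_t' u_t) < ∞`. -/
structure IsAdmissible [MeasurableSpace Ω] (μ : Measure Ω) (ω : ℕ → Fin (D + 1) → Ω → ℝ)
    (K₀ : Matrix (Fin m) (Fin n) ℝ) (K : Fin D → Matrix (Fin m) (Fin m) ℝ)
    (x : ℕ → Ω → Fin n → ℝ) (u : ℤ → Ω → Fin m → ℝ) : Prop where
  feedback : ∀ (t : ℕ) (θ : Ω), u (t : ℤ) θ = K₀ *ᵥ x t θ +
    ∑ τ : Fin D, K τ *ᵥ u ((t : ℤ) - (((τ : ℕ) : ℤ) + 1)) θ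
  adapted : ∀ t : ℕ, Measurable[past ω t] (u (t : ℤ))
  integrable : ∀ t : ℕ, Integrable (fun θ => u (t : ℤ) θ ⬝ᵥ u (t : ℤ) θ) μ
  summable : Summable fun t : ℕ => ∫ θ, u (t : ℤ) θ ⬝ᵥ u (t : ℤ) θ ∂μ

/-- Asymptotic mean-square stabilizability: there are feedback gains such that, for all
(deterministic) initial values `x_0` and `u_{-1}, …, u_{-D}`, the closed-loop control is admissible
and `E (x_t' x_t) → 0`. (The initial values and gains determine `x_t` and `u_t` for all `t ≥ 0`, so
`∃ x u` names this one trajectory.) -/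
def MeanSquareStabilizable [MeasurableSpace Ω] (μ : Measure Ω) (A : Matrix (Fin n) (Fin n) ℝ)
    (B C : Fin (D + 1) → Matrix (Fin n) (Fin m) ℝ) (ω : ℕ → Fin (D + 1) → Ω → ℝ) : Prop :=
  ∃ (K₀ : Matrix (Fin m) (Fin n) ℝ) (K : Fin D → Matrix (Fin m) (Fin m) ℝ),
    ∀ (x₀ : Fin n → ℝ) (u₀ : Fin D → Fin m → ℝ),
      ∃ (x : ℕ → Ω → Fin n → ℝ) (u : ℤ → Ω → Fin m → ℝ),
        (∀ θ, x 0 θ = x₀) ∧ (∀ (τ : Fin D) (θ : Ω), u (-(((τ : ℕ) : ℤ) + 1)) θ = u₀ τ) ∧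
        IsSolution A B C ω x u ∧ IsAdmissible μ ω K₀ K x u ∧
        (∀ t, Integrable (fun θ => x t θ ⬝ᵥ x t θ) μ) ∧
        Tendsto (fun t => ∫ θ, x t θ ⬝ᵥ x t θ ∂μ) atTop (𝓝 0)

/-- `L = ∑_{j=0}^D A^{D-j} B_j`. -/
def inputMatrix (A : Matrix (Fin n) (Fin n) ℝ) (B : Fin (D + 1) → Matrix (Fin n) (Fin m) ℝ) :
    Matrix (Fin n) (Fin m) ℝ :=
  ∑ j : Fin (D + 1), A ^ (D - (j : ℕ)) * B j

/-- `M < 0`: the real matrix `M` is symmetric and negative definite. -/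
def NegDef {ι : Type*} (M : Matrix ι ι ℝ) : Prop := (-M).PosDef

/-- The symmetric block matrix with `D + 3` block rows: `S` in every diagonal block, first block
column `S, A S + L Y, σ_0 A^D C_0 Y, …, σ_D A^D C_D Y`, first block row its transpose, and zero
blocks elsewhere. -/
def lmiMatrix (A : Matrix (Fin n) (Fin n) ℝ) (B C : Fin (D + 1) → Matrix (Fin n) (Fin m) ℝ)
    (σ : Fin (D + 1) → ℝ) (Y : Matrix (Fin m) (Fin n) ℝ) (S : Matrix (Fin n) (Fin n) ℝ) :
    Matrix (Fin n ⊕ (Fin n ⊕ Fin n × Fin (D + 1))) (Fin n ⊕ (Fin n ⊕ Fin n × Fin (D + 1))) ℝ :=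
  let N : Matrix (Fin n ⊕ Fin n × Fin (D + 1)) (Fin n) ℝ :=
    Matrix.fromRows (A * S + inputMatrix A B * Y)
      (Matrix.of fun p k => (σ p.2 • (A ^ D * C p.2 * Y)) p.1 k)
  Matrix.fromBlocks S Nᵀ N
    (Matrix.fromBlocks S 0 0 (Matrix.blockDiagonal fun _ : Fin (D + 1) => S))

end MultiDelay

/-! The D-step predictor y_t = A^D x_t + (a combination of u_{t-1}, …, u_{t-D}) obeys y_{t+1} = A
y_t + L u_t + ∑ ω_t^τ A^D C_τ u_{t-τ} (`predictor_succ`): the delays leave the drift and survive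
only in the noise. Since ω_t is independent of the past, centred and uncorrelated across channels,
E(y y') follows a linear recursion in which the delayed controls enter only through their own second
moments (`gram_add_sum_noise`). Summed over time, a delay merely shifts the summation index, so up
to boundary terms the recursion is that of the delay-free map X ↦ ∑ F_a X F_a', with F_a the
matrices of `closedLoop`.

Sufficiency: with u_t = -K y_t and a Lyapunov matrix P, summing tr(P E(y y')) telescopes, the
terminal terms have a favourable sign, and E|y_t|² is summable. Then u is summable too, and x is
recovered because A^D is invertible.

Necessity: run the given stabilizing control from initial data with y_0 = e_i for each i, and let X
be the sum of E(y y') over i and t < T. Least-squares regression of u on y gives a static gain K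
plus an orthogonal residual (`exists_regression`). As Y_0 = 1 and the terminal terms vanish for
large T, X strictly dominates ∑ F_a X F_a'; duality (`exists_posDef_of_dual`) converts X into a
Lyapunov matrix P.

The Lyapunov inequality and the block inequality are linked by a Schur complement
(`negDef_lmiMatrix_iff`). -/

namespace MultiDelay

/-! ### Positive definite matrices, Schur complement and duality -/

section MatrixFacts

variable {ι κ : Type*} [Fintype ι] [Fintype κ]

theorem exists_eq_transpose_mul_self {P : Matrix ι ι ℝ} (hP : P.PosSemidef) :
    ∃ R : Matrix ι ι ℝ, P = Rᵀ * R := by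
  classical
  open scoped MatrixOrder in
  obtain ⟨R, hR⟩ := CStarAlgebra.nonneg_iff_eq_star_mul_self.1 hP.nonneg
  exact ⟨R, by simpa [Matrix.star_eq_conjTranspose] using hR⟩

theorem posSemidef_conj {P : Matrix ι ι ℝ} (hP : P.PosSemidef) (F : Matrix κ ι ℝ) :
    (F * P * Fᵀ).PosSemidef := by
  simpa using hP.mul_mul_conjTranspose_same F

theorem posSemidef_conj' {P : Matrix ι ι ℝ} (hP : P.PosSemidef) (F : Matrix ι κ ℝ) :
    (Fᵀ * P * F).PosSemidef := by
  simpa using hP.conjTranspose_mul_mul_same F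

theorem trace_mul_nonneg {P Y : Matrix ι ι ℝ} (hP : P.PosSemidef) (hY : Y.PosSemidef) :
    0 ≤ (P * Y).trace := by
  obtain ⟨R, rfl⟩ := exists_eq_transpose_mul_self hP
  rw [Matrix.mul_assoc, Matrix.trace_mul_comm]
  exact (posSemidef_conj hY R).trace_nonneg

theorem mulVec_dotProduct_self_le (M : Matrix κ ι ℝ) (v : ι → ℝ) :
    (M *ᵥ v) ⬝ᵥ (M *ᵥ v) ≤ (Mᵀ * M).trace * (v ⬝ᵥ v) := by
  rw [Matrix.trace_mul_comm]
  simp only [dotProduct, Matrix.mulVec, Matrix.trace, Matrix.diag, Matrix.mul_apply,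
    Matrix.transpose_apply, Finset.sum_mul (s := (Finset.univ : Finset κ))]
  refine Finset.sum_le_sum fun i _ => ?_
  have := Finset.sum_mul_sq_le_sq_mul_sq Finset.univ (M i) v
  simpa only [sq] using this

theorem posSemidef_trace_smul_one_sub [DecidableEq ι] {P : Matrix ι ι ℝ} (hP : P.PosSemidef) :
    (P.trace • (1 : Matrix ι ι ℝ) - P).PosSemidef := by
  refine .of_dotProduct_mulVec_nonneg
    (Matrix.IsHermitian.sub (by simp [Matrix.IsHermitian]) hP.1) fun x => ?_
  obtain ⟨R, rfl⟩ := exists_eq_transpose_mul_self hP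
  have h := mulVec_dotProduct_self_le R x
  rw [Matrix.dotProduct_mulVec, Matrix.vecMul_mulVec, ← Matrix.dotProduct_mulVec] at h
  simp only [star_trivial, Matrix.sub_mulVec, dotProduct_sub, Matrix.smul_mulVec,
    Matrix.one_mulVec, dotProduct_smul, smul_eq_mul]
  linarith

theorem posDef_one_sub_of_trace_lt_one [DecidableEq ι] {P : Matrix ι ι ℝ} (hP : P.PosSemidef)
    (h : P.trace < 1) : (1 - P).PosDef := by
  have h1 : ((1 - P.trace) • (1 : Matrix ι ι ℝ)).PosDef := Matrix.PosDef.one.smul (by linarith)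
  convert h1.add_posSemidef (posSemidef_trace_smul_one_sub hP) using 1
  rw [sub_smul, one_smul]; abel

/-- Writing Q⁻¹ = R'R, one has R R' ≤ tr(Q⁻¹)·1; conjugating by R⁻¹ turns this into a lower bound
for Q. -/
theorem exists_smul_one_le [DecidableEq ι] {Q : Matrix ι ι ℝ} (hQ : Q.PosDef) :
    ∃ c : ℝ, 0 < c ∧ (Q - c • (1 : Matrix ι ι ℝ)).PosSemidef := by
  obtain ⟨R, hR⟩ := exists_eq_transpose_mul_self hQ.inv.posSemidef
  -- The added 1 keeps b positive even when the index type is empty.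
  set b := Q⁻¹.trace + 1
  have hb : 0 < b := by have := hQ.inv.posSemidef.trace_nonneg; positivity
  refine ⟨b⁻¹, by positivity, ?_⟩
  have hu : IsUnit (R * Rᵀ) := by
    have := hQ.inv.isUnit
    rw [Matrix.isUnit_iff_isUnit_det] at this ⊢
    rw [hR, Matrix.det_mul, mul_comm] at this
    rwa [Matrix.det_mul]
  have hR1 : IsUnit R := by
    rw [Matrix.isUnit_iff_isUnit_det] at hu ⊢
    rw [Matrix.det_mul] at hu
    exact isUnit_of_mul_isUnit_left hu
  have hP : (R * Rᵀ).PosSemidef := by simpa using Matrix.posSemidef_self_mul_conjTranspose R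
  have h1 := posSemidef_trace_smul_one_sub hP
  have ht : (R * Rᵀ).trace + 1 = b := by rw [Matrix.trace_mul_comm, ← hR]
  have h2 : (b • (1 : Matrix ι ι ℝ) - R * Rᵀ).PosSemidef := by
    convert h1.add Matrix.PosSemidef.one using 1
    rw [← ht, add_smul, one_smul]; abel
  have hd : IsUnit R.det := (Matrix.isUnit_iff_isUnit_det _).1 hR1
  have hdT : IsUnit Rᵀ.det := by rwa [Matrix.det_transpose]
  have hQR : Q = R⁻¹ * (R⁻¹)ᵀ := by
    rw [← Matrix.nonsing_inv_nonsing_inv Q ((Matrix.isUnit_iff_isUnit_det _).1 hQ.isUnit), hR,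
      Matrix.mul_inv_rev, Matrix.transpose_nonsing_inv]
  have h3 := (posSemidef_conj h2 R⁻¹).smul (α := ℝ) (a := b⁻¹) (by positivity)
  convert h3 using 1
  rw [Matrix.mul_sub, Matrix.sub_mul, Matrix.mul_smul, Matrix.smul_mul, Matrix.mul_one, ← hQR,
    Matrix.transpose_nonsing_inv, ← Matrix.mul_assoc, Matrix.nonsing_inv_mul _ hd, Matrix.one_mul,
    Matrix.mul_nonsing_inv _ hdT, smul_sub, smul_smul, inv_mul_cancel₀ hb.ne', one_smul]

theorem exists_smul_le [DecidableEq ι] {Q M : Matrix ι ι ℝ} (hQ : Q.PosDef) (hM : M.PosSemidef) :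
    ∃ c : ℝ, 0 < c ∧ c < 1 ∧ (Q - c • M).PosSemidef := by
  obtain ⟨c, hc, h⟩ := exists_smul_one_le hQ
  set b := M.trace
  have hb : 0 ≤ b := hM.trace_nonneg
  -- Chosen so that e < 1 and e b ≤ c; then Q - eM = (Q - c) + e(b - M) + (c - e b) is a sum of
  -- positive semidefinite terms.
  set e := c / (b + c + 1)
  have he : 0 < e := by positivity
  refine ⟨e, he, ?_, ?_⟩
  · rw [div_lt_one (by positivity)]; linarith
  · have h1 := (posSemidef_trace_smul_one_sub hM).smul (α := ℝ) (a := e) he.le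
    have h2 : 0 ≤ c - e * b := by
      have : e * b ≤ e * (b + c + 1) := mul_le_mul_of_nonneg_left (by linarith) he.le
      rw [div_mul_cancel₀ _ (by positivity)] at this
      linarith
    have h3 := (Matrix.PosSemidef.one (n := ι) (R := ℝ)).smul (α := ℝ) h2
    convert (h.add h1).add h3 using 1
    rw [smul_sub, smul_smul, sub_smul]; abel

theorem posDef_fromBlocks₂₂_iff [DecidableEq κ] (P : Matrix ι ι ℝ) (N : Matrix ι κ ℝ)
    {Q : Matrix κ κ ℝ} (hQ : Q.PosDef) :
    (Matrix.fromBlocks P N Nᵀ Q).PosDef ↔ (P - N * Q⁻¹ * Nᵀ).PosDef := by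
  have := hQ.isUnit.invertible
  simp only [← Matrix.conjTranspose_eq_transpose_of_trivial]
  rw [Matrix.posDef_iff_dotProduct_mulVec, Matrix.IsHermitian.fromBlocks₂₂ _ _ hQ.1]
  constructor
  · refine fun h => .of_dotProduct_mulVec_pos h.1 fun x hx => ?_
    -- This second component minimizes the quadratic form for fixed x, leaving exactly the Schur
    -- complement.
    have h2 := h.2 (x := Sum.elim x (-((Q⁻¹ * Nᴴ) *ᵥ x)))
      (fun h0 => hx (by simpa using congrArg (· ∘ Sum.inl) h0))
    rwa [Matrix.dotProduct_mulVec, Matrix.schur_complement_eq₂₂ P N _ _ hQ.1, add_neg_cancel,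
      dotProduct_zero, zero_add, ← Matrix.dotProduct_mulVec] at h2
  · refine fun h => ⟨h.1, fun x hx => ?_⟩
    obtain ⟨y, z, rfl⟩ : ∃ y z, x = Sum.elim y z := ⟨_, _, (Sum.elim_comp_inl_inr x).symm⟩
    rw [Matrix.dotProduct_mulVec, Matrix.schur_complement_eq₂₂ P N _ _ hQ.1,
      ← Matrix.dotProduct_mulVec, ← Matrix.dotProduct_mulVec]
    by_cases hy : y = 0
    · subst hy
      have hz : z ≠ 0 := by
        rintro rfl
        exact hx (by ext (i | i) <;> rfl)
      simpa using hQ.dotProduct_mulVec_pos hz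
    · exact add_pos_of_nonneg_of_pos (hQ.posSemidef.dotProduct_mulVec_nonneg _)
        (h.dotProduct_mulVec_pos hy)

theorem blockDiagonal_mul_blockDiagonal_self_eq_one [DecidableEq ι] [DecidableEq κ]
    {P Q : Matrix ι ι ℝ} (h : P * Q = 1) :
    (Matrix.blockDiagonal fun _ : κ => P) * (Matrix.blockDiagonal fun _ : κ => Q) = 1 := by
  rw [← Matrix.blockDiagonal_mul, h]
  exact Matrix.blockDiagonal_one

theorem posDef_blockDiagonal [DecidableEq ι] [DecidableEq κ] {P : Matrix ι ι ℝ} (hP : P.PosDef) :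
    (Matrix.blockDiagonal fun _ : κ => P).PosDef := by
  obtain ⟨R, hR⟩ := exists_eq_transpose_mul_self hP.posSemidef
  have hd : IsUnit (Rᵀ.det * R.det) := by
    rw [← Matrix.det_mul, ← hR]; exact (Matrix.isUnit_iff_isUnit_det _).1 hP.isUnit
  have h1 := blockDiagonal_mul_blockDiagonal_self_eq_one (κ := κ)
    (Matrix.nonsing_inv_mul R (isUnit_of_mul_isUnit_right hd))
  have h2 : Function.Injective (Matrix.blockDiagonal fun _ : κ => R).mulVec :=
    Matrix.mulVec_injective_of_isUnit (IsUnit.of_mul_eq_one_right _ h1)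
  have h3 := Matrix.PosDef.conjTranspose_mul_self _ h2
  rwa [Matrix.conjTranspose_eq_transpose_of_trivial, Matrix.blockDiagonal_transpose,
    ← Matrix.blockDiagonal_mul, ← hR] at h3

/-- A family of matrices whose sum of congruences `X ↦ ∑ F X F'` strictly contracts some positive
definite matrix also has an adjoint `P ↦ ∑ F' P F` strictly contracting one. -/
theorem exists_posDef_of_dual [DecidableEq ι] (F : κ → Matrix ι ι ℝ) {X : Matrix ι ι ℝ}
    (hX : X.PosDef) (h : (X - ∑ a, F a * X * (F a)ᵀ).PosDef) :
    ∃ P : Matrix ι ι ℝ, P.PosDef ∧ (P - ∑ a, (F a)ᵀ * P * F a).PosDef := by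
  set T : Matrix ι ι ℝ → Matrix ι ι ℝ := fun X => ∑ a, F a * X * (F a)ᵀ with hT
  set T' : Matrix ι ι ℝ → Matrix ι ι ℝ := fun X => ∑ a, (F a)ᵀ * X * F a with hT'
  have T_psd : ∀ {M}, M.PosSemidef → (T M).PosSemidef := fun hM =>
    Matrix.posSemidef_sum _ fun a _ => posSemidef_conj hM (F a)
  have T'_psd : ∀ {M}, M.PosSemidef → (T' M).PosSemidef := fun hM =>
    Matrix.posSemidef_sum _ fun a _ => posSemidef_conj' hM (F a)
  have T_sub : ∀ M N, T (M - N) = T M - T N := fun M N => by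
    simp only [hT, Matrix.mul_sub, Matrix.sub_mul, Finset.sum_sub_distrib]
  have T_smul : ∀ (c : ℝ) M, T (c • M) = c • T M := fun c M => by
    simp only [hT, Matrix.mul_smul, Matrix.smul_mul, Finset.smul_sum]
  have T'_add : ∀ M N, T' (M + N) = T' M + T' N := fun M N => by
    simp only [hT', Matrix.mul_add, Matrix.add_mul, Finset.sum_add_distrib]
  have T'_zero : T' 0 = 0 := by simp [hT']
  have dual : ∀ M N, (T M * N).trace = (M * T' N).trace := fun M N => by
    simp only [hT, hT', Finset.sum_mul, Finset.mul_sum, Matrix.trace_sum]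
    refine Finset.sum_congr rfl fun a _ => ?_
    rw [Matrix.mul_assoc, Matrix.mul_assoc, Matrix.trace_mul_comm]
    simp only [Matrix.mul_assoc]
  have dual_iter : ∀ (k : ℕ) M N, (T^[k] M * N).trace = (M * T'^[k] N).trace := by
    intro k
    induction k with
    | zero => intro M N; rfl
    | succ k ih => intro M N; rw [Function.iterate_succ_apply' T, dual, ih, Function.iterate_succ_apply]
  have T'_iter_psd : ∀ k : ℕ, (T'^[k] (1 : Matrix ι ι ℝ)).PosSemidef := by
    intro k
    induction k with
    | zero => exact Matrix.PosSemidef.one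
    | succ k ih => rw [Function.iterate_succ_apply' T']; exact T'_psd ih
  -- X - T X ≥ c X gives T X ≤ (1 - c) X, hence geometric decay of the iterates of T on X.
  obtain ⟨c, hc0, hc1, hc⟩ := exists_smul_le h hX.posSemidef
  have hTX : ∀ k : ℕ, ((1 - c) ^ k • X - T^[k] X).PosSemidef := by
    intro k
    induction k with
    | zero => simpa using Matrix.PosSemidef.zero
    | succ k ih =>
      have h1 := (T_psd ih).add (hc.smul (α := ℝ) (a := (1 - c) ^ k) (pow_nonneg (by linarith) k))
      rw [T_sub, T_smul, ← Function.iterate_succ_apply' T] at h1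
      convert h1 using 1
      have : X - ∑ a, F a * X * (F a)ᵀ = X - T X := rfl
      rw [this, pow_succ, smul_sub, smul_sub, smul_smul, mul_sub, mul_one, sub_smul]
      abel
  -- X ≥ d·1 transfers the decay to the adjoint: d tr(T'^k 1) ≤ tr(X T'^k 1) = tr(T^k X).
  obtain ⟨d, hd0, -, hd⟩ := exists_smul_le hX (Matrix.PosSemidef.one (n := ι) (R := ℝ))
  have hbound : ∀ k : ℕ, d * (T'^[k] (1 : Matrix ι ι ℝ)).trace ≤ (1 - c) ^ k * X.trace := by
    intro k
    have h1 := trace_mul_nonneg hd (T'_iter_psd k)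
    rw [Matrix.sub_mul, Matrix.trace_sub, ← dual_iter, Matrix.mul_one, Matrix.smul_mul,
      Matrix.one_mul, Matrix.trace_smul, smul_eq_mul] at h1
    have h2 := (hTX k).trace_nonneg
    rw [Matrix.trace_sub, Matrix.trace_smul, smul_eq_mul] at h2
    linarith
  have hlim : Tendsto (fun k : ℕ => (1 - c) ^ k * X.trace) atTop (𝓝 0) := by
    simpa using (tendsto_pow_atTop_nhds_zero_of_lt_one (r := 1 - c) (by linarith)
      (by linarith)).mul_const X.trace
  obtain ⟨k, hk, hk0⟩ := ((hlim.eventually_lt_const hd0).and (eventually_gt_atTop 0)).exists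
  have htr : (T'^[k] (1 : Matrix ι ι ℝ)).trace < 1 := by
    have := hbound k
    by_contra! hge
    nlinarith
  have hsum : ∀ k : ℕ, T' (∑ i ∈ Finset.range k, T'^[i] 1) =
      ∑ i ∈ Finset.range k, T'^[i + 1] (1 : Matrix ι ι ℝ) := by
    intro k
    induction k with
    | zero => simpa using T'_zero
    | succ k ih => rw [Finset.sum_range_succ, T'_add, ih, Finset.sum_range_succ,
        Function.iterate_succ_apply' T' k]
  -- A truncated Neumann series: P - T'P telescopes to 1 - T'^k 1, which is positive definite once
  -- the trace of T'^k 1 is below 1.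
  refine ⟨∑ i ∈ Finset.range k, T'^[i] 1, ?_, ?_⟩
  · obtain ⟨j, rfl⟩ := Nat.exists_eq_succ_of_ne_zero hk0.ne'
    rw [Finset.sum_range_succ']
    exact Matrix.PosDef.posSemidef_add (Matrix.posSemidef_sum _ fun i _ => T'_iter_psd _)
      Matrix.PosDef.one
  · have h1 : (∑ i ∈ Finset.range k, T'^[i] (1 : Matrix ι ι ℝ)) -
        T' (∑ i ∈ Finset.range k, T'^[i] 1) = 1 - T'^[k] 1 := by
      rw [hsum, ← Finset.sum_sub_distrib]
      exact Finset.sum_range_sub' (fun i => T'^[i] (1 : Matrix ι ι ℝ)) k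
    exact h1 ▸ posDef_one_sub_of_trace_lt_one (T'_iter_psd k) htr

end MatrixFacts

/-! ### The block inequality and the Lyapunov inequality -/

section Lmi

variable {n m D : ℕ}

/-- The coefficient matrices of the closed-loop second-moment recursion under `u = -K y`: the drift
`A - L K` and, for every noise channel, `σ_τ A^D C_τ K`. -/
def closedLoop (A : Matrix (Fin n) (Fin n) ℝ) (B C : Fin (D + 1) → Matrix (Fin n) (Fin m) ℝ)
    (σ : Fin (D + 1) → ℝ) (K : Matrix (Fin m) (Fin n) ℝ) :
    Option (Fin (D + 1)) → Matrix (Fin n) (Fin n) ℝ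
  | none => A - inputMatrix A B * K
  | some τ => σ τ • (A ^ D * C τ * K)

theorem sum_closedLoop_dual (A : Matrix (Fin n) (Fin n) ℝ)
    (B C : Fin (D + 1) → Matrix (Fin n) (Fin m) ℝ) (σ : Fin (D + 1) → ℝ)
    (K : Matrix (Fin m) (Fin n) ℝ) (P : Matrix (Fin n) (Fin n) ℝ) :
    ∑ a, (closedLoop A B C σ K a)ᵀ * P * closedLoop A B C σ K a =
      (A - inputMatrix A B * K)ᵀ * P * (A - inputMatrix A B * K) +
          ∑ τ : Fin (D + 1),
            σ τ ^ 2 • (Kᵀ * (C τ)ᵀ * (Aᵀ) ^ D * P * A ^ D * C τ * K) := by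
  rw [Fintype.sum_option]
  simp only [closedLoop, Matrix.transpose_smul, Matrix.transpose_mul, Matrix.transpose_pow,
    Matrix.smul_mul, Matrix.mul_smul, smul_smul, Matrix.mul_assoc, sq]

theorem sum_closedLoop (A : Matrix (Fin n) (Fin n) ℝ)
    (B C : Fin (D + 1) → Matrix (Fin n) (Fin m) ℝ) (σ : Fin (D + 1) → ℝ)
    (K : Matrix (Fin m) (Fin n) ℝ) (X : Matrix (Fin n) (Fin n) ℝ) :
    ∑ a, closedLoop A B C σ K a * X * (closedLoop A B C σ K a)ᵀ =
      (A - inputMatrix A B * K) * X * (A - inputMatrix A B * K)ᵀ +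
          ∑ τ : Fin (D + 1),
            σ τ ^ 2 • (A ^ D * C τ * (K * X * Kᵀ) * (A ^ D * C τ)ᵀ) := by
  rw [Fintype.sum_option]
  simp only [closedLoop, Matrix.transpose_smul, Matrix.transpose_mul, Matrix.transpose_pow,
    Matrix.smul_mul, Matrix.mul_smul, smul_smul, Matrix.mul_assoc, sq]

/-- The negated block matrix has lower right block diag(P⁻¹, …, P⁻¹). Its Schur complement is P⁻¹(P
- ∑ F'PF)P⁻¹, congruent to the Lyapunov expression. -/
theorem negDef_lmiMatrix_iff (A : Matrix (Fin n) (Fin n) ℝ)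
    (B C : Fin (D + 1) → Matrix (Fin n) (Fin m) ℝ) (σ : Fin (D + 1) → ℝ)
    (K : Matrix (Fin m) (Fin n) ℝ) {P : Matrix (Fin n) (Fin n) ℝ} (hP : P.PosDef) :
    NegDef (lmiMatrix A B C σ (K * P⁻¹) (-P⁻¹)) ↔
      (P - ∑ a, (closedLoop A B C σ K a)ᵀ * P * closedLoop A B C σ K a).PosDef := by
  set E : Matrix (Fin n × Fin (D + 1)) (Fin n) ℝ :=
    Matrix.of fun p k => (σ p.2 • (A ^ D * C p.2 * K)) p.1 k with hE
  -- Negating A S + L Y gives (A - LK)P⁻¹, whereas the noise blocks keep a minus sign, harmless in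
  -- the quadratic expression.
  set N : Matrix (Fin n ⊕ Fin n × Fin (D + 1)) (Fin n) ℝ :=
    Matrix.fromRows (A - inputMatrix A B * K) (-E) with hN
  set Q : Matrix (Fin n ⊕ Fin n × Fin (D + 1)) (Fin n ⊕ Fin n × Fin (D + 1)) ℝ :=
    Matrix.fromBlocks P⁻¹ 0 0 (Matrix.blockDiagonal fun _ : Fin (D + 1) => P⁻¹) with hQ
  have hPu : IsUnit P.det := (Matrix.isUnit_iff_isUnit_det _).1 hP.isUnit
  have hsymm : P⁻¹ᵀ = P⁻¹ := by
    rw [← Matrix.conjTranspose_eq_transpose_of_trivial]; exact hP.inv.1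
  have hQP : Q.PosDef := by
    have h := (posDef_fromBlocks₂₂_iff P⁻¹ 0
      (posDef_blockDiagonal (κ := Fin (D + 1)) hP.inv)).2 (by simpa using hP.inv)
    simpa [hQ] using h
  have hQi : Q⁻¹ = Matrix.fromBlocks P 0 0 (Matrix.blockDiagonal fun _ : Fin (D + 1) => P) := by
    refine Matrix.inv_eq_right_inv ?_
    rw [hQ, Matrix.fromBlocks_multiply]
    simp [Matrix.nonsing_inv_mul _ hPu,
      blockDiagonal_mul_blockDiagonal_self_eq_one (Matrix.nonsing_inv_mul _ hPu)]
  have hEP : (Matrix.of fun (p : Fin n × Fin (D + 1)) k =>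
      (σ p.2 • (A ^ D * C p.2 * (K * P⁻¹))) p.1 k) = E * P⁻¹ := by
    ext p k
    simp only [Matrix.of_apply]
    rw [← Matrix.mul_assoc, ← Matrix.smul_mul]
    rfl
  have hneg : -lmiMatrix A B C σ (K * P⁻¹) (-P⁻¹) =
      Matrix.fromBlocks P⁻¹ (N * P⁻¹)ᵀ ((N * P⁻¹)ᵀ)ᵀ Q := by
    have h1 : N * P⁻¹ = -Matrix.fromRows (A * -P⁻¹ + inputMatrix A B * (K * P⁻¹)) (E * P⁻¹) := by
      rw [hN, Matrix.fromRows_mul, Matrix.fromRows_neg]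
      congr 1
      · simp only [Matrix.sub_mul, Matrix.mul_neg, Matrix.mul_assoc]; abel
      · rw [Matrix.neg_mul]
    have h2 : (Matrix.blockDiagonal fun _ : Fin (D + 1) => -P⁻¹) =
        -Matrix.blockDiagonal fun _ : Fin (D + 1) => P⁻¹ := Matrix.blockDiagonal_neg _
    rw [Matrix.transpose_transpose, h1, lmiMatrix, hEP, h2, Matrix.fromBlocks_neg,
      Matrix.fromBlocks_neg, Matrix.transpose_neg]
    simp [hQ]
  have hE2 : Eᵀ * (Matrix.blockDiagonal fun _ : Fin (D + 1) => P) * E =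
      ∑ τ, (closedLoop A B C σ K (some τ))ᵀ * P * closedLoop A B C σ K (some τ) := by
    ext i j
    simp only [Matrix.mul_apply, Matrix.sum_apply, Matrix.transpose_apply, hE, Matrix.of_apply,
      Matrix.blockDiagonal_apply, Fintype.sum_prod_type, closedLoop]
    rw [Finset.sum_comm]
    simp
  have hS : P⁻¹ - (N * P⁻¹)ᵀ * Q⁻¹ * ((N * P⁻¹)ᵀ)ᵀ = P⁻¹ *
      (P - ∑ a, (closedLoop A B C σ K a)ᵀ * P * closedLoop A B C σ K a) * P⁻¹ := by
    have h1 : Nᵀ * Q⁻¹ * N = ∑ a, (closedLoop A B C σ K a)ᵀ * P * closedLoop A B C σ K a := by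
      rw [Fintype.sum_option, ← hE2, hQi, hN, Matrix.transpose_fromRows,
        Matrix.fromCols_mul_fromBlocks, Matrix.fromCols_mul_fromRows]
      simp [closedLoop]
    rw [← h1, Matrix.mul_sub, Matrix.sub_mul, Matrix.nonsing_inv_mul _ hPu, Matrix.one_mul,
      Matrix.transpose_transpose, Matrix.transpose_mul, hsymm]
    simp only [Matrix.mul_assoc]
  rw [NegDef, hneg, posDef_fromBlocks₂₂_iff _ _ hQP, hS]
  have h3 := Matrix.IsUnit.posDef_star_left_conjugate_iff (U := P⁻¹)
    (x := P - ∑ a, (closedLoop A B C σ K a)ᵀ * P * closedLoop A B C σ K a) hP.inv.isUnit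
  rwa [Matrix.star_eq_conjTranspose, Matrix.conjTranspose_eq_transpose_of_trivial, hsymm] at h3

/-- The substitution P = (-S)⁻¹, K = YP is invertible. -/
theorem exists_lmi_iff (A : Matrix (Fin n) (Fin n) ℝ)
    (B C : Fin (D + 1) → Matrix (Fin n) (Fin m) ℝ) (σ : Fin (D + 1) → ℝ) :
    (∃ (Y : Matrix (Fin m) (Fin n) ℝ) (S : Matrix (Fin n) (Fin n) ℝ),
        NegDef S ∧ NegDef (lmiMatrix A B C σ Y S)) ↔
      ∃ (K : Matrix (Fin m) (Fin n) ℝ) (P : Matrix (Fin n) (Fin n) ℝ), P.PosDef ∧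
        (P - ∑ a, (closedLoop A B C σ K a)ᵀ * P * closedLoop A B C σ K a).PosDef := by
  constructor
  · rintro ⟨Y, S, hS, h⟩
    have hu : IsUnit (-S).det := (Matrix.isUnit_iff_isUnit_det _).1 hS.isUnit
    refine ⟨Y * (-S)⁻¹, (-S)⁻¹, hS.inv, ?_⟩
    rw [← negDef_lmiMatrix_iff A B C σ _ hS.inv, Matrix.nonsing_inv_nonsing_inv _ hu,
      Matrix.mul_assoc, Matrix.nonsing_inv_mul _ hu, Matrix.mul_one, neg_neg]
    exact h
  · rintro ⟨K, P, hP, h⟩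
    exact ⟨K * P⁻¹, -P⁻¹, by simpa [NegDef] using hP.inv, (negDef_lmiMatrix_iff A B C σ K hP).2 h⟩

end Lmi

/-! ### Second-moment matrices and mean-square convergence -/

section SecondMoments

variable {Ω : Type*} [MeasurableSpace Ω] {μ : Measure Ω} {ι κ α : Type*}

/-- The random vector `f` is square integrable. -/
def SqInt (μ : Measure Ω) (f : Ω → ι → ℝ) : Prop := ∀ i, MemLp (fun θ => f θ i) 2 μ

/-- The matrix `E (f g')` of mixed second moments of two random vectors. -/
noncomputable def gram (μ : Measure Ω) (f : Ω → ι → ℝ) (g : Ω → κ → ℝ) : Matrix ι κ ℝ :=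
  Matrix.of fun i j => ∫ θ, f θ i * g θ j ∂μ

theorem SqInt.integrable_mul {f : Ω → ι → ℝ} {g : Ω → κ → ℝ} (hf : SqInt μ f) (hg : SqInt μ g)
    (i : ι) (j : κ) : Integrable (fun θ => f θ i * g θ j) μ :=
  MemLp.integrable_mul (hf i) (hg j)

theorem SqInt.add {f g : Ω → ι → ℝ} (hf : SqInt μ f) (hg : SqInt μ g) :
    SqInt μ fun θ => f θ + g θ := fun i => (hf i).add (hg i)

theorem SqInt.sum {s : Finset α} {f : α → Ω → ι → ℝ} (hf : ∀ a ∈ s, SqInt μ (f a)) :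
    SqInt μ fun θ => ∑ a ∈ s, f a θ := fun i => by
  simp only [Finset.sum_apply]
  exact memLp_finsetSum s fun a ha => hf a ha i

theorem SqInt.mulVec [Fintype ι] {f : Ω → ι → ℝ} (hf : SqInt μ f) (M : Matrix κ ι ℝ) :
    SqInt μ fun θ => M *ᵥ f θ := fun i =>
  memLp_finsetSum Finset.univ fun j _ => (hf j).const_mul (M i j)

theorem SqInt.of_integrable [Fintype ι] {f : Ω → ι → ℝ} (hm : Measurable f)
    (h : Integrable (fun θ => f θ ⬝ᵥ f θ) μ) : SqInt μ f := fun i => by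
  have hmi : Measurable fun θ => f θ i := (measurable_pi_apply i).comp hm
  rw [memLp_two_iff_integrable_sq hmi.aestronglyMeasurable]
  refine h.mono' (hmi.pow_const 2).aestronglyMeasurable (.of_forall fun θ => ?_)
  rw [Real.norm_of_nonneg (sq_nonneg _), sq]
  exact Finset.single_le_sum (f := fun i => f θ i * f θ i)
    (fun j _ => mul_self_nonneg _) (Finset.mem_univ i)

theorem SqInt.integrable_dotProduct [Fintype ι] {f : Ω → ι → ℝ} (hf : SqInt μ f) :
    Integrable (fun θ => f θ ⬝ᵥ f θ) μ :=
  integrable_finsetSum _ fun i _ => hf.integrable_mul hf i i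

theorem trace_gram_self [Fintype ι] {f : Ω → ι → ℝ} (hf : SqInt μ f) :
    (gram μ f f).trace = ∫ θ, f θ ⬝ᵥ f θ ∂μ :=
  (integral_finsetSum _ fun i _ => hf.integrable_mul hf i i).symm

theorem gram_transpose (f : Ω → ι → ℝ) (g : Ω → κ → ℝ) : (gram μ f g)ᵀ = gram μ g f := by
  ext i j
  simp only [gram, Matrix.transpose_apply, Matrix.of_apply, mul_comm]

theorem gram_add_left {f f' : Ω → ι → ℝ} {g : Ω → κ → ℝ} (hf : SqInt μ f) (hf' : SqInt μ f')
    (hg : SqInt μ g) : gram μ (fun θ => f θ + f' θ) g = gram μ f g + gram μ f' g := by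
  ext i j
  simp only [gram, Matrix.add_apply, Matrix.of_apply, Pi.add_apply, add_mul]
  exact integral_add (hf.integrable_mul hg i j) (hf'.integrable_mul hg i j)

theorem gram_add_right {f : Ω → ι → ℝ} {g g' : Ω → κ → ℝ} (hf : SqInt μ f) (hg : SqInt μ g)
    (hg' : SqInt μ g') : gram μ f (fun θ => g θ + g' θ) = gram μ f g + gram μ f g' := by
  rw [← gram_transpose, gram_add_left hg hg' hf, Matrix.transpose_add, gram_transpose,
    gram_transpose]

theorem gram_sum_left {s : Finset α} {f : α → Ω → ι → ℝ} {g : Ω → κ → ℝ}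
    (hf : ∀ a ∈ s, SqInt μ (f a)) (hg : SqInt μ g) :
    gram μ (fun θ => ∑ a ∈ s, f a θ) g = ∑ a ∈ s, gram μ (f a) g := by
  ext i j
  simp only [gram, Matrix.sum_apply, Matrix.of_apply, Finset.sum_apply, Finset.sum_mul]
  exact integral_finsetSum _ fun a ha => (hf a ha).integrable_mul hg i j

theorem gram_sum_right {s : Finset α} {f : Ω → ι → ℝ} {g : α → Ω → κ → ℝ}
    (hf : SqInt μ f) (hg : ∀ a ∈ s, SqInt μ (g a)) :
    gram μ f (fun θ => ∑ a ∈ s, g a θ) = ∑ a ∈ s, gram μ f (g a) := by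
  rw [← gram_transpose, gram_sum_left hg hf, Matrix.transpose_sum]
  simp only [gram_transpose]

theorem gram_mulVec_left [Fintype ι] {f : Ω → ι → ℝ} {g : Ω → κ → ℝ} (hf : SqInt μ f)
    (hg : SqInt μ g) (M : Matrix α ι ℝ) :
    gram μ (fun θ => M *ᵥ f θ) g = M * gram μ f g := by
  ext i j
  simp only [gram, Matrix.mul_apply, Matrix.of_apply, Matrix.mulVec, dotProduct, Finset.sum_mul,
    mul_assoc]
  rw [integral_finsetSum _ fun k _ => (hf.integrable_mul hg k j).const_mul (M i k)]
  exact Finset.sum_congr rfl fun k _ => integral_const_mul _ _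

theorem gram_mulVec_right [Fintype κ] {f : Ω → ι → ℝ} {g : Ω → κ → ℝ} (hf : SqInt μ f)
    (hg : SqInt μ g) (M : Matrix α κ ℝ) :
    gram μ f (fun θ => M *ᵥ g θ) = gram μ f g * Mᵀ := by
  rw [← gram_transpose, gram_mulVec_left hg hf, Matrix.transpose_mul, gram_transpose]

theorem gram_mulVec_mulVec [Fintype ι] {f : Ω → ι → ℝ} (hf : SqInt μ f) (M : Matrix κ ι ℝ) :
    gram μ (fun θ => M *ᵥ f θ) (fun θ => M *ᵥ f θ) = M * gram μ f f * Mᵀ := by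
  rw [gram_mulVec_left hf (hf.mulVec M), gram_mulVec_right hf hf, Matrix.mul_assoc]

theorem gram_add_self {f g : Ω → ι → ℝ} (hf : SqInt μ f) (hg : SqInt μ g) :
    gram μ (fun θ => f θ + g θ) (fun θ => f θ + g θ) =
      gram μ f f + gram μ g f + gram μ f g + gram μ g g := by
  rw [gram_add_left hf hg (hf.add hg), gram_add_right hf hf hg, gram_add_right hg hf hg]
  abel

theorem posSemidef_gram_self [Fintype ι] {f : Ω → ι → ℝ} (hf : SqInt μ f) :
    (gram μ f f).PosSemidef := by
  refine .of_dotProduct_mulVec_nonneg ?_ fun x => ?_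
  · rw [Matrix.IsHermitian, Matrix.conjTranspose_eq_transpose_of_trivial, gram_transpose]
  -- x' E(ff') x = E((x'f)²), read off as the only entry of a 1×1 moment matrix.
  · have h := gram_mulVec_mulVec hf (Matrix.replicateRow Unit x)
    have h1 := congrFun (congrFun h ()) ()
    have h2 : (Matrix.replicateRow Unit x * gram μ f f * (Matrix.replicateRow Unit x)ᵀ) () () =
        star x ⬝ᵥ (gram μ f f *ᵥ x) := by
      rw [Matrix.mul_assoc]
      simp [Matrix.mul_apply, Matrix.mulVec, dotProduct]
    rw [← h2, ← h1]
    exact integral_nonneg fun θ => mul_self_nonneg _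

/-- A sequence of square integrable random vectors tending to zero in mean square. -/
def MeanSquareNull (μ : Measure Ω) [Fintype ι] (f : ℕ → Ω → ι → ℝ) : Prop :=
  (∀ t, SqInt μ (f t)) ∧ Tendsto (fun t => (gram μ (f t) (f t)).trace) atTop (𝓝 0)

theorem trace_gram_mulVec_le [Fintype ι] [Fintype κ] {f : Ω → ι → ℝ} (hf : SqInt μ f)
    (M : Matrix κ ι ℝ) : (gram μ (fun θ => M *ᵥ f θ) (fun θ => M *ᵥ f θ)).trace ≤
      (Mᵀ * M).trace * (gram μ f f).trace := by
  classical
  have hM : (Mᵀ * M).PosSemidef := by simpa using Matrix.posSemidef_conjTranspose_mul_self M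
  have h := trace_mul_nonneg (posSemidef_trace_smul_one_sub hM) (posSemidef_gram_self hf)
  rw [Matrix.sub_mul, Matrix.trace_sub, Matrix.smul_mul, Matrix.one_mul, Matrix.trace_smul,
    smul_eq_mul, sub_nonneg] at h
  rwa [gram_mulVec_mulVec hf, Matrix.trace_mul_comm, ← Matrix.mul_assoc]

theorem MeanSquareNull.mulVec [Fintype ι] [Fintype κ] {f : ℕ → Ω → ι → ℝ}
    (hf : MeanSquareNull μ f) (M : Matrix κ ι ℝ) :
    MeanSquareNull μ fun t θ => M *ᵥ f t θ := by
  refine ⟨fun t => (hf.1 t).mulVec M, squeeze_zero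
    (fun t => (posSemidef_gram_self ((hf.1 t).mulVec M)).trace_nonneg)
    (fun t => trace_gram_mulVec_le (hf.1 t) M) ?_⟩
  simpa using hf.2.const_mul (Mᵀ * M).trace

theorem MeanSquareNull.add [Fintype ι] {f g : ℕ → Ω → ι → ℝ}
    (hf : MeanSquareNull μ f) (hg : MeanSquareNull μ g) :
    MeanSquareNull μ fun t θ => f t θ + g t θ := by
  have hs := fun t => (hf.1 t).add (hg.1 t)
  have hlim : Tendsto (fun t => 2 * (gram μ (f t) (f t)).trace + 2 * (gram μ (g t) (g t)).trace)
      atTop (𝓝 0) := by simpa using (hf.2.const_mul 2).add (hg.2.const_mul 2)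
  refine ⟨hs, squeeze_zero (fun t => (posSemidef_gram_self (hs t)).trace_nonneg) (fun t => ?_) hlim⟩
  rw [trace_gram_self (hs t), trace_gram_self (hf.1 t), trace_gram_self (hg.1 t),
    ← integral_const_mul, ← integral_const_mul, ← integral_add
      ((hf.1 t).integrable_dotProduct.const_mul 2) ((hg.1 t).integrable_dotProduct.const_mul 2)]
  refine integral_mono (hs t).integrable_dotProduct
    (((hf.1 t).integrable_dotProduct.const_mul 2).add
      ((hg.1 t).integrable_dotProduct.const_mul 2)) fun θ => ?_
  simp only [dotProduct, Finset.mul_sum, ← Finset.sum_add_distrib, Pi.add_apply]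
  exact Finset.sum_le_sum fun i _ => by nlinarith [sq_nonneg (f t θ i - g t θ i)]

theorem MeanSquareNull.sum [Fintype ι] {s : Finset α} {f : α → ℕ → Ω → ι → ℝ}
    (hf : ∀ a ∈ s, MeanSquareNull μ (f a)) : MeanSquareNull μ fun t θ => ∑ a ∈ s, f a t θ := by
  classical
  induction s using Finset.induction_on with
  | empty => exact ⟨fun t i => by simp, by simp [gram, Matrix.trace]⟩
  | insert a s ha ih =>
    simp only [Finset.sum_insert ha]
    exact (hf a (by simp)).add (ih fun b hb => hf b (by simp [hb]))

end SecondMoments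

/-! ### The filtration of the noise -/

section Past

variable {D : ℕ} {Ω : Type*} {ω : ℕ → Fin (D + 1) → Ω → ℝ}

theorem past_mono {s t : ℕ} (h : s ≤ t) : past ω s ≤ past ω t :=
  iSup₂_le fun r hr => le_iSup₂_of_le r (hr.trans_le h) le_rfl

theorem measurable_past_noise {s t : ℕ} (h : s < t) (τ : Fin (D + 1)) :
    Measurable[past ω t] (ω s τ) := by
  have h1 : MeasurableSpace.comap (fun (θ : Ω) (τ : Fin (D + 1)) => ω s τ θ) inferInstance ≤
      past ω t := le_iSup₂ (f := fun (r : ℕ) (_ : r < t) =>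
        MeasurableSpace.comap (fun (θ : Ω) (τ : Fin (D + 1)) => ω r τ θ) inferInstance) s h
  exact ((measurable_pi_apply τ).comp (comap_measurable (fun θ τ => ω s τ θ))).mono h1 le_rfl

end Past

/-! ### Independence of the noise from the past -/

section Noise

variable {D : ℕ} {Ω : Type*} [MeasurableSpace Ω] {μ : Measure Ω}
  {ω : ℕ → Fin (D + 1) → Ω → ℝ} {σ : Fin (D + 1) → ℝ} {ι κ : Type*}

theorem IsNoise.comap_le (hω : IsNoise μ ω σ) (t : ℕ) :
    MeasurableSpace.comap (fun θ τ => ω t τ θ) inferInstance ≤ ‹MeasurableSpace Ω› :=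
  (measurable_pi_lambda _ fun τ => hω.measurable t τ).comap_le

theorem IsNoise.past_le (hω : IsNoise μ ω σ) (t : ℕ) : past ω t ≤ ‹MeasurableSpace Ω› :=
  iSup₂_le fun s _ => hω.comap_le s

/-- A general φ is needed because channels at one time may be dependent: coordinates, their squares
and their products are all used. -/
theorem IsNoise.indepFun (hω : IsNoise μ ω σ) {t : ℕ} {φ : (Fin (D + 1) → ℝ) → ℝ}
    (hφ : Measurable φ) {y : Ω → ℝ} (hy : Measurable[past ω t] y) :
    IndepFun (fun θ => φ fun τ => ω t τ θ) y μ := by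
  rw [IndepFun_iff_Indep]
  have h := indep_iSup_of_disjoint hω.comap_le hω.indep.iIndep (S := {t}) (T := {s | s < t})
    (by simp)
  refine indep_of_indep_of_le_left (indep_of_indep_of_le_right h hy.comap_le) ?_
  rw [iSup_singleton]
  exact (hφ.comp (comap_measurable fun θ τ => ω t τ θ)).comap_le

/-- The random vector `f` is square integrable and determined by the noise before time `t`. -/
def PastSqInt (μ : Measure Ω) (ω : ℕ → Fin (D + 1) → Ω → ℝ) (t : ℕ) (f : Ω → ι → ℝ) : Prop :=
  (∀ i, Measurable[past ω t] fun θ => f θ i) ∧ SqInt μ f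

theorem PastSqInt.const [IsProbabilityMeasure μ] (t : ℕ) (v : ι → ℝ) : PastSqInt μ ω t fun _ => v :=
  ⟨fun _ => measurable_const, fun _ => memLp_const _⟩

theorem PastSqInt.mono {s t : ℕ} {f : Ω → ι → ℝ} (hf : PastSqInt μ ω s f) (h : s ≤ t) :
    PastSqInt μ ω t f := ⟨fun i => (hf.1 i).mono (past_mono h) le_rfl, hf.2⟩

theorem PastSqInt.add {t : ℕ} {f g : Ω → ι → ℝ} (hf : PastSqInt μ ω t f)
    (hg : PastSqInt μ ω t g) : PastSqInt μ ω t fun θ => f θ + g θ :=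
  ⟨fun i => (hf.1 i).add (hg.1 i), hf.2.add hg.2⟩

theorem PastSqInt.sum {α : Type*} {t : ℕ} {s : Finset α} {f : α → Ω → ι → ℝ}
    (hf : ∀ a ∈ s, PastSqInt μ ω t (f a)) : PastSqInt μ ω t fun θ => ∑ a ∈ s, f a θ := by
  refine ⟨fun i => ?_, SqInt.sum fun a ha => (hf a ha).2⟩
  simp only [Finset.sum_apply]
  exact Finset.measurable_fun_sum s fun a ha => (hf a ha).1 i

theorem PastSqInt.mulVec [Fintype ι] {t : ℕ} {f : Ω → ι → ℝ} (hf : PastSqInt μ ω t f)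
    (M : Matrix κ ι ℝ) : PastSqInt μ ω t fun θ => M *ᵥ f θ :=
  ⟨fun i => Finset.measurable_fun_sum _ fun j _ => (hf.1 j).const_mul (M i j), hf.2.mulVec M⟩

/-- A product of two L² variables is in general only L¹; independence makes the product of the
squares integrable. -/
theorem PastSqInt.sqInt_noise_smul (hω : IsNoise μ ω σ) {t : ℕ} {f : Ω → ι → ℝ}
    (hf : PastSqInt μ ω t f) (τ : Fin (D + 1)) : SqInt μ fun θ => ω t τ θ • f θ := fun i => by
  have hm : Measurable fun θ => f θ i := (hf.1 i).mono (hω.past_le t) le_rfl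
  refine (memLp_two_iff_integrable_sq ((hω.measurable t τ).mul hm).aestronglyMeasurable).2 ?_
  have h := (hω.indepFun (φ := fun v => v τ ^ 2) ((measurable_pi_apply τ).pow_const 2)
    ((hf.1 i).pow_const 2)).integrable_mul (hω.memLp t τ).integrable_sq (hf.2 i).integrable_sq
  exact h.congr (.of_forall fun θ => (mul_pow _ _ _).symm)

theorem PastSqInt.noise_smul (hω : IsNoise μ ω σ) {t : ℕ} {f : Ω → ι → ℝ}
    (hf : PastSqInt μ ω t f) (τ : Fin (D + 1)) :
    PastSqInt μ ω (t + 1) fun θ => ω t τ θ • f θ :=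
  ⟨fun i => (measurable_past_noise t.lt_succ_self τ).mul ((hf.mono t.le_succ).1 i),
    hf.sqInt_noise_smul hω τ⟩

theorem gram_noise_left (hω : IsNoise μ ω σ) {t : ℕ} {f : Ω → ι → ℝ} {g : Ω → κ → ℝ}
    (hf : PastSqInt μ ω t f) (hg : PastSqInt μ ω t g) (τ : Fin (D + 1)) :
    gram μ (fun θ => ω t τ θ • f θ) g = 0 := by
  ext i j
  have hm := (hf.1 i).mul (hg.1 j)
  have h := (hω.indepFun (φ := fun v => v τ) (measurable_pi_apply τ)
    hm).integral_fun_mul_eq_mul_integral (hω.measurable t τ).aestronglyMeasurable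
    (hm.mono (hω.past_le t) le_rfl).aestronglyMeasurable
  simp only [gram, Matrix.of_apply, Matrix.zero_apply, Pi.smul_apply, smul_eq_mul, mul_assoc]
  exact h.trans (by rw [hω.mean, zero_mul])

theorem gram_noise_noise (hω : IsNoise μ ω σ) {t : ℕ} {f : Ω → ι → ℝ} {g : Ω → κ → ℝ}
    (hf : PastSqInt μ ω t f) (hg : PastSqInt μ ω t g) (τ ρ : Fin (D + 1)) :
    gram μ (fun θ => ω t τ θ • f θ) (fun θ => ω t ρ θ • g θ) =
      if τ = ρ then σ τ ^ 2 • gram μ f g else 0 := by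
  have key : gram μ (fun θ => ω t τ θ • f θ) (fun θ => ω t ρ θ • g θ) =
      (∫ θ, ω t τ θ * ω t ρ θ ∂μ) • gram μ f g := by
    ext i j
    have hm := (hf.1 i).mul (hg.1 j)
    have h := (hω.indepFun (φ := fun v => v τ * v ρ)
      ((measurable_pi_apply τ).mul (measurable_pi_apply ρ))
      hm).integral_fun_mul_eq_mul_integral
      ((hω.measurable t τ).mul (hω.measurable t ρ)).aestronglyMeasurable
      (hm.mono (hω.past_le t) le_rfl).aestronglyMeasurable
    simp only [gram, Matrix.of_apply, Matrix.smul_apply, Pi.smul_apply, smul_eq_mul]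
    exact Eq.trans (integral_congr_ae (.of_forall fun θ => by simp only [Pi.mul_apply]; ring)) h
  rw [key]
  split_ifs with h
  · subst h
    rw [← hω.variance t τ]
    simp only [sq]
  · rw [hω.uncorrelated t τ ρ h, zero_smul]

/-- Independence and uncorrelatedness of the noise leave only the diagonal second moments. -/
theorem gram_add_sum_noise [Fintype κ] (hω : IsNoise μ ω σ) {t : ℕ} {z : Ω → ι → ℝ}
    {f : Fin (D + 1) → Ω → κ → ℝ} (hz : PastSqInt μ ω t z) (hf : ∀ τ, PastSqInt μ ω t (f τ))
    (G : Fin (D + 1) → Matrix ι κ ℝ) :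
    gram μ (fun θ => z θ + ∑ τ, ω t τ θ • (G τ *ᵥ f τ θ))
        (fun θ => z θ + ∑ τ, ω t τ θ • (G τ *ᵥ f τ θ)) =
      gram μ z z + ∑ τ, σ τ ^ 2 • (G τ * gram μ (f τ) (f τ) * (G τ)ᵀ) := by
  have hGf := fun τ => (hf τ).mulVec (G τ)
  have hs : ∀ τ ∈ Finset.univ, SqInt μ fun θ => ω t τ θ • (G τ *ᵥ f τ θ) := fun τ _ =>
    (hGf τ).sqInt_noise_smul hω τ
  have h1 : gram μ (fun θ => ∑ τ, ω t τ θ • (G τ *ᵥ f τ θ)) z = 0 := by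
    rw [gram_sum_left hs hz.2]
    exact Finset.sum_eq_zero fun τ _ => gram_noise_left hω (hGf τ) hz τ
  have h2 : gram μ z (fun θ => ∑ τ, ω t τ θ • (G τ *ᵥ f τ θ)) = 0 := by
    rw [← gram_transpose, h1, Matrix.transpose_zero]
  rw [gram_add_self hz.2 (SqInt.sum hs), h1, h2, gram_sum_left hs (SqInt.sum hs), add_zero,
    add_zero]
  congr 1
  refine Finset.sum_congr rfl fun τ _ => ?_
  rw [gram_sum_right (hs τ (Finset.mem_univ τ)) hs]
  simp only [gram_noise_noise hω (hGf τ) (hGf _)]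
  rw [Finset.sum_ite_eq Finset.univ τ, if_pos (Finset.mem_univ τ), gram_mulVec_mulVec (hf τ).2]

end Noise

/-! ### The predictor and its delay-free drift -/

section Predictor

variable {n m D : ℕ} {Ω : Type*}

/-- The weight of the control applied `i + 1` steps ago in the predicted state `D` steps ahead. -/
def delayCoeff (A : Matrix (Fin n) (Fin n) ℝ) (B : Fin (D + 1) → Matrix (Fin n) (Fin m) ℝ)
    (i : ℕ) : Matrix (Fin n) (Fin m) ℝ :=
  ∑ j : Fin (D + 1), if i < (j : ℕ) then A ^ (D + i - (j : ℕ)) * B j else 0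

/-- The state predicted `D` steps ahead from the past controls alone. -/
def predictor (A : Matrix (Fin n) (Fin n) ℝ) (B : Fin (D + 1) → Matrix (Fin n) (Fin m) ℝ)
    (x : ℕ → Ω → Fin n → ℝ) (u : ℤ → Ω → Fin m → ℝ) (t : ℕ) (θ : Ω) : Fin n → ℝ :=
  A ^ D *ᵥ x t θ + ∑ i : Fin D, delayCoeff A B i *ᵥ u ((t : ℤ) - (((i : ℕ) : ℤ) + 1)) θ

theorem delayCoeff_zero_add (A : Matrix (Fin n) (Fin n) ℝ)
    (B : Fin (D + 1) → Matrix (Fin n) (Fin m) ℝ) :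
    delayCoeff A B 0 + A ^ D * B 0 = inputMatrix A B := by
  simp [delayCoeff, inputMatrix, Fin.sum_univ_succ, add_comm]

theorem delayCoeff_self (A : Matrix (Fin n) (Fin n) ℝ)
    (B : Fin (D + 1) → Matrix (Fin n) (Fin m) ℝ) : delayCoeff A B D = 0 :=
  Finset.sum_eq_zero fun j _ => if_neg (by omega)

/-- Both sides carry the same powers of A on the B_j with j > i + 1; the term j = i + 1 on the right
is A^D B_{i+1}. Since j ≤ D, the natural subtraction in the exponents never truncates. -/
theorem delayCoeff_succ_add (A : Matrix (Fin n) (Fin n) ℝ)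
    (B : Fin (D + 1) → Matrix (Fin n) (Fin m) ℝ) (i : Fin D) :
    delayCoeff A B ((i : ℕ) + 1) + A ^ D * B i.succ = A * delayCoeff A B i := by
  have h : A ^ D * B i.succ = ∑ j : Fin (D + 1), if i.succ = j then A ^ D * B j else 0 := by simp
  rw [h, delayCoeff, delayCoeff, Matrix.mul_sum, ← Finset.sum_add_distrib]
  refine Finset.sum_congr rfl fun j _ => ?_
  have hj := j.isLt
  have hiff : i.succ = j ↔ (i : ℕ) + 1 = j := by rw [Fin.ext_iff, Fin.val_succ]
  have hr : (A * if (i : ℕ) < j then A ^ (D + i - j) * B j else 0) =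
      if (i : ℕ) < j then A ^ (D + i - j + 1) * B j else 0 := by
    split_ifs
    · rw [← Matrix.mul_assoc, ← pow_succ']
    · exact Matrix.mul_zero _
  rw [hr]
  rcases lt_trichotomy ((i : ℕ) + 1) j with hlt | heq | hgt
  · rw [if_pos hlt, if_neg (by rw [hiff]; omega), if_pos (by omega), add_zero]
    congr 2; omega
  · rw [if_neg (by omega), if_pos (hiff.2 heq), if_pos (by omega), zero_add]
    congr 2; omega
  · rw [if_neg (by omega), if_neg (by rw [hiff]; omega), if_neg (by omega), add_zero]

theorem predictor_succ {A : Matrix (Fin n) (Fin n) ℝ}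
    {B C : Fin (D + 1) → Matrix (Fin n) (Fin m) ℝ} {ω : ℕ → Fin (D + 1) → Ω → ℝ}
    {x : ℕ → Ω → Fin n → ℝ} {u : ℤ → Ω → Fin m → ℝ} (h : IsSolution A B C ω x u) (t : ℕ) (θ : Ω) :
    predictor A B x u (t + 1) θ =
      (A *ᵥ predictor A B x u t θ + inputMatrix A B *ᵥ u (t : ℤ) θ) +
        ∑ τ : Fin (D + 1), ω t τ θ • ((A ^ D * C τ) *ᵥ u ((t : ℤ) - ((τ : ℕ) : ℤ)) θ) := by
  -- The coefficient of index D vanishes, so the sum may be extended to all D + 1 channels and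
  -- matched with the state equation.
  have h1 : ∑ i : Fin D, delayCoeff A B i *ᵥ u (((t + 1 : ℕ) : ℤ) - (((i : ℕ) : ℤ) + 1)) θ =
      ∑ τ : Fin (D + 1), delayCoeff A B τ *ᵥ u ((t : ℤ) - ((τ : ℕ) : ℤ)) θ := by
    rw [Fin.sum_univ_castSucc, Fin.val_last, delayCoeff_self, Matrix.zero_mulVec, add_zero]
    refine Finset.sum_congr rfl fun i _ => ?_
    rw [Fin.val_castSucc]
    congr 2
    push_cast; ring
  have h2 : ∑ τ : Fin (D + 1), (delayCoeff A B τ + A ^ D * B τ) *ᵥ u ((t : ℤ) - ((τ : ℕ) : ℤ)) θ =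
      inputMatrix A B *ᵥ u (t : ℤ) θ +
        A *ᵥ ∑ i : Fin D, delayCoeff A B i *ᵥ u ((t : ℤ) - (((i : ℕ) : ℤ) + 1)) θ := by
    rw [Fin.sum_univ_succ, Matrix.mulVec_sum]
    congr 1
    · rw [Fin.val_zero, delayCoeff_zero_add]; simp
    · refine Finset.sum_congr rfl fun i _ => ?_
      rw [Fin.val_succ, delayCoeff_succ_add, ← Matrix.mulVec_mulVec]
      push_cast; rfl
  have h3 : A ^ D *ᵥ (A *ᵥ x t θ) = A *ᵥ (A ^ D *ᵥ x t θ) := by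
    rw [Matrix.mulVec_mulVec, Matrix.mulVec_mulVec, ← pow_succ, ← pow_succ']
  rw [predictor, h1, h t θ, predictor, Matrix.mulVec_add, Matrix.mulVec_add, h3,
    Matrix.mulVec_sum, add_assoc (A *ᵥ _) (A *ᵥ _), add_comm (A *ᵥ ∑ i, _), ← h2]
  simp only [Matrix.add_mulVec, Matrix.mulVec_add, Matrix.smul_mulVec, Matrix.mulVec_smul,
    Matrix.mulVec_mulVec, Finset.sum_add_distrib]
  abel

end Predictor

/-! ### Closed-loop trajectories and their moment recursion -/

section ClosedLoop

variable {n m D : ℕ} {Ω : Type*}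

/-- Initial data and feedback gains determine a trajectory. -/
theorem exists_trajectory (A : Matrix (Fin n) (Fin n) ℝ)
    (B C : Fin (D + 1) → Matrix (Fin n) (Fin m) ℝ) (ω : ℕ → Fin (D + 1) → Ω → ℝ)
    (K₀ : Matrix (Fin m) (Fin n) ℝ) (K : Fin D → Matrix (Fin m) (Fin m) ℝ)
    (x₀ : Fin n → ℝ) (v : ℕ → Fin m → ℝ) :
    ∃ (x : ℕ → Ω → Fin n → ℝ) (u : ℤ → Ω → Fin m → ℝ), (∀ θ, x 0 θ = x₀) ∧
      (∀ (k : ℕ) (θ : Ω), u (-((k : ℤ) + 1)) θ = v k) ∧ IsSolution A B C ω x u ∧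
      ∀ (t : ℕ) (θ : Ω), u (t : ℤ) θ = K₀ *ᵥ x t θ +
        ∑ τ : Fin D, K τ *ᵥ u ((t : ℤ) - (((τ : ℕ) : ℤ) + 1)) θ := by
  let fb : (Fin n → ℝ) × (ℕ → Fin m → ℝ) → Fin m → ℝ := fun s =>
    K₀ *ᵥ s.1 + ∑ τ : Fin D, K τ *ᵥ s.2 τ
  let hist : (Fin n → ℝ) × (ℕ → Fin m → ℝ) → ℕ → Fin m → ℝ := fun s k =>
    Nat.casesOn k (fb s) s.2
  -- The recursion carries x_t with the whole control history k ↦ u_{t-1-k}; `hist` prepends u_t. At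
  -- t = 0 this matches `Int.negSucc k` = -(k + 1).
  let st : Ω → ℕ → (Fin n → ℝ) × (ℕ → Fin m → ℝ) := fun θ t => Nat.rec (x₀, v) (fun t s =>
    (A *ᵥ s.1 + ∑ τ : Fin (D + 1), (B τ + ω t τ θ • C τ) *ᵥ hist s τ, hist s)) t
  let u : ℤ → Ω → Fin m → ℝ := fun z θ => Int.casesOn z (fun t => fb (st θ t)) v
  have hpast : ∀ (t k : ℕ) (θ : Ω), (st θ t).2 k = u ((t : ℤ) - ((k : ℤ) + 1)) θ := by
    intro t
    induction t with
    | zero =>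
      intro k θ
      have : ((0 : ℕ) : ℤ) - ((k : ℤ) + 1) = Int.negSucc k := by rw [Int.negSucc_eq]; simp
      rw [this]
      rfl
    | succ t ih =>
      intro k θ
      cases k with
      | zero =>
        have : ((t + 1 : ℕ) : ℤ) - (((0 : ℕ) : ℤ) + 1) = Int.ofNat t := by simp
        rw [this]
        rfl
      | succ k =>
        have : ((t + 1 : ℕ) : ℤ) - (((k + 1 : ℕ) : ℤ) + 1) = (t : ℤ) - ((k : ℤ) + 1) := by
          push_cast; ring
        rw [this, ← ih k θ]
  have hfb : ∀ (t : ℕ) (θ : Ω), u (t : ℤ) θ = K₀ *ᵥ (st θ t).1 +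
        ∑ τ : Fin D, K τ *ᵥ u ((t : ℤ) - (((τ : ℕ) : ℤ) + 1)) θ := fun t θ => by
    simp only [← hpast]
    rfl
  have hhist : ∀ (t k : ℕ) (θ : Ω), hist (st θ t) k = u ((t : ℤ) - (k : ℤ)) θ := by
    intro t k θ
    have h := hpast (t + 1) k θ
    have h1 : ((t + 1 : ℕ) : ℤ) - ((k : ℤ) + 1) = (t : ℤ) - k := by push_cast; ring
    rw [h1] at h
    exact h
  refine ⟨fun t θ => (st θ t).1, u, fun θ => rfl, fun k θ => ?_, fun t θ => ?_, hfb⟩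
  · rw [← Int.negSucc_eq]
  · simp only [← hhist]
    rfl

variable [MeasurableSpace Ω] {μ : Measure Ω} {ω : ℕ → Fin (D + 1) → Ω → ℝ} {σ : Fin (D + 1) → ℝ}
  {A : Matrix (Fin n) (Fin n) ℝ} {B C : Fin (D + 1) → Matrix (Fin n) (Fin m) ℝ}
  {x : ℕ → Ω → Fin n → ℝ} {u : ℤ → Ω → Fin m → ℝ}

theorem IsSolution.pastSqInt_succ (hω : IsNoise μ ω σ) (h : IsSolution A B C ω x u) {t : ℕ}
    (hx : PastSqInt μ ω t (x t))
    (hu : ∀ τ : Fin (D + 1), PastSqInt μ ω t (u ((t : ℤ) - ((τ : ℕ) : ℤ)))) :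
    PastSqInt μ ω (t + 1) (x (t + 1)) := by
  have h1 : x (t + 1) = fun θ => A *ᵥ x t θ + ∑ τ : Fin (D + 1),
      (B τ *ᵥ u ((t : ℤ) - ((τ : ℕ) : ℤ)) θ +
        ω t τ θ • (C τ *ᵥ u ((t : ℤ) - ((τ : ℕ) : ℤ)) θ)) := by
    funext θ
    simp only [h t θ, Matrix.add_mulVec, Matrix.smul_mulVec]
  rw [h1]
  exact ((hx.mulVec A).mono t.le_succ).add (PastSqInt.sum fun τ _ =>
    (((hu τ).mulVec (B τ)).mono t.le_succ).add (((hu τ).mulVec (C τ)).noise_smul hω τ))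

theorem pastSqInt_predictor {t : ℕ} (hx : PastSqInt μ ω t (x t))
    (hu : ∀ τ : Fin D, PastSqInt μ ω t (u ((t : ℤ) - (((τ : ℕ) : ℤ) + 1)))) :
    PastSqInt μ ω t (predictor A B x u t) :=
  (hx.mulVec (A ^ D)).add (PastSqInt.sum fun τ _ => (hu τ).mulVec (delayCoeff A B τ))

theorem IsSolution.gram_predictor_succ (hω : IsNoise μ ω σ) (h : IsSolution A B C ω x u) {t : ℕ}
    (hy : PastSqInt μ ω t (predictor A B x u t))
    (hu : ∀ τ : Fin (D + 1), PastSqInt μ ω t (u ((t : ℤ) - ((τ : ℕ) : ℤ)))) :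
    gram μ (predictor A B x u (t + 1)) (predictor A B x u (t + 1)) =
      gram μ (fun θ => A *ᵥ predictor A B x u t θ + inputMatrix A B *ᵥ u (t : ℤ) θ)
        (fun θ => A *ᵥ predictor A B x u t θ + inputMatrix A B *ᵥ u (t : ℤ) θ) +
      ∑ τ : Fin (D + 1), σ τ ^ 2 • (A ^ D * C τ * gram μ (u ((t : ℤ) - ((τ : ℕ) : ℤ)))
        (u ((t : ℤ) - ((τ : ℕ) : ℤ))) * (A ^ D * C τ)ᵀ) := by
  have hu0 : PastSqInt μ ω t (u (t : ℤ)) := by simpa using hu 0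
  have h1 : predictor A B x u (t + 1) = fun θ =>
      (A *ᵥ predictor A B x u t θ + inputMatrix A B *ᵥ u (t : ℤ) θ) +
        ∑ τ : Fin (D + 1), ω t τ θ • ((A ^ D * C τ) *ᵥ u ((t : ℤ) - ((τ : ℕ) : ℤ)) θ) :=
    funext (predictor_succ h t)
  rw [h1]
  exact gram_add_sum_noise hω ((hy.mulVec A).add (hu0.mulVec _)) hu _

end ClosedLoop

/-! ### Time shifts of limits and sums -/

section Shift

theorem tendsto_sub_natCast {g : ℤ → ℝ} {l : Filter ℝ} (h : Tendsto (fun t : ℕ => g t) atTop l)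
    (k : ℕ) : Tendsto (fun t : ℕ => g ((t : ℤ) - k)) atTop l := by
  rw [← tendsto_add_atTop_iff_nat k]
  simpa using h

theorem sum_range_sub_natCast {M : Type*} [AddCommGroup M] (g : ℤ → M) (k T : ℕ) :
    ∑ t ∈ Finset.range T, g ((t : ℤ) - k) =
      ∑ j ∈ Finset.range k, g ((j : ℤ) - k) + ∑ t ∈ Finset.range T, g t -
        ∑ j ∈ Finset.range k, g (((T + j : ℕ) : ℤ) - k) := by
  rw [eq_sub_iff_add_eq, ← Finset.sum_range_add (fun t : ℕ => g ((t : ℤ) - k)) T k, add_comm T k,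
    Finset.sum_range_add]
  congr 1
  exact Finset.sum_congr rfl fun t _ => by congr 1; push_cast; ring

end Shift

/-! ### Sufficiency: a Lyapunov matrix yields stabilization -/

section Sufficiency

variable {n m D : ℕ} {Ω : Type*} [MeasurableSpace Ω] {μ : Measure Ω}
  {ω : ℕ → Fin (D + 1) → Ω → ℝ} {σ : Fin (D + 1) → ℝ}
  {A : Matrix (Fin n) (Fin n) ℝ} {B C : Fin (D + 1) → Matrix (Fin n) (Fin m) ℝ}

theorem trace_sum_dual {ι κ : Type*} [Fintype ι] [Fintype κ] (F : κ → Matrix ι ι ℝ)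
    (P Y : Matrix ι ι ℝ) :
    ((∑ a, (F a)ᵀ * P * F a) * Y).trace = (P * ∑ a, F a * Y * (F a)ᵀ).trace := by
  rw [Matrix.sum_mul, Matrix.mul_sum, Matrix.trace_sum, Matrix.trace_sum]
  refine Finset.sum_congr rfl fun a _ => ?_
  rw [Matrix.mul_assoc, Matrix.mul_assoc, Matrix.trace_mul_comm]
  simp only [Matrix.mul_assoc]

/-- The predicted state is summable in mean square under a feedback admitting a Lyapunov matrix. -/
theorem summable_trace_gram_predictor (hω : IsNoise μ ω σ) {K : Matrix (Fin m) (Fin n) ℝ}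
    {P : Matrix (Fin n) (Fin n) ℝ} (hP : P.PosDef)
    (hQ : (P - ∑ a, (closedLoop A B C σ K a)ᵀ * P * closedLoop A B C σ K a).PosDef)
    {x : ℕ → Ω → Fin n → ℝ} {u : ℤ → Ω → Fin m → ℝ} (hsol : IsSolution A B C ω x u)
    (hu : ∀ (t : ℕ) (τ : Fin (D + 1)), PastSqInt μ ω t (u ((t : ℤ) - ((τ : ℕ) : ℤ))))
    (hy : ∀ t, PastSqInt μ ω t (predictor A B x u t))
    (hfb : ∀ (t : ℕ) (θ : Ω), u (t : ℤ) θ = (-K) *ᵥ predictor A B x u t θ) :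
    Summable fun t => (gram μ (predictor A B x u t) (predictor A B x u t)).trace := by
  set y := predictor A B x u with hydef
  set Y : ℕ → Matrix (Fin n) (Fin n) ℝ := fun t => gram μ (y t) (y t) with hY
  set Q := P - ∑ a, (closedLoop A B C σ K a)ᵀ * P * closedLoop A B C σ K a with hQdef
  -- The P-weighted energy that the control of time z injects through channel τ.
  set q : Fin (D + 1) → ℤ → ℝ := fun τ z =>
    σ τ ^ 2 * (P * (A ^ D * C τ * gram μ (u z) (u z) * (A ^ D * C τ)ᵀ)).trace with hq
  have hYpsd : ∀ t, (Y t).PosSemidef := fun t => posSemidef_gram_self (hy t).2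
  have hq0 : ∀ (τ : Fin (D + 1)) (t : ℕ), 0 ≤ q τ ((t : ℤ) - ((τ : ℕ) : ℤ)) := fun τ t =>
    mul_nonneg (sq_nonneg _) (trace_mul_nonneg hP.posSemidef
      (posSemidef_conj (posSemidef_gram_self (hu t τ).2) _))
  have hgu : ∀ t : ℕ, gram μ (u (t : ℤ)) (u (t : ℤ)) = K * Y t * Kᵀ := fun t => by
    rw [show u (t : ℤ) = fun θ => (-K) *ᵥ y t θ from funext (hfb t), gram_mulVec_mulVec (hy t).2]
    simp [hY]
  have hdrift : ∀ t : ℕ, gram μ (fun θ => A *ᵥ y t θ + inputMatrix A B *ᵥ u (t : ℤ) θ)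
      (fun θ => A *ᵥ y t θ + inputMatrix A B *ᵥ u (t : ℤ) θ) =
      (A - inputMatrix A B * K) * Y t * (A - inputMatrix A B * K)ᵀ := fun t => by
    rw [← gram_mulVec_mulVec (hy t).2]
    congr 1 <;> funext θ <;>
    rw [hfb, Matrix.sub_mulVec, Matrix.neg_mulVec, Matrix.mulVec_neg, ← Matrix.mulVec_mulVec,
      sub_eq_add_neg]
  -- The delay-free Lyapunov decrease is corrected only by the differences q(t-τ) - q(t), whose sums
  -- over time reduce to boundary terms.
  have hstep : ∀ t : ℕ, (P * Y (t + 1)).trace = (P * Y t).trace - (Q * Y t).trace +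
      ∑ τ : Fin (D + 1), (q τ ((t : ℤ) - ((τ : ℕ) : ℤ)) - q τ t) := fun t => by
    have h1 : (P * Y (t + 1)).trace =
        (P * ((A - inputMatrix A B * K) * Y t * (A - inputMatrix A B * K)ᵀ)).trace +
          ∑ τ : Fin (D + 1), q τ ((t : ℤ) - ((τ : ℕ) : ℤ)) := by
      have h0 : Y (t + 1) = _ := hsol.gram_predictor_succ hω (hy t) (hu t)
      rw [h0, ← hydef, hdrift, Matrix.mul_add, Matrix.trace_add, Matrix.mul_sum, Matrix.trace_sum]
      simp only [hq, Matrix.mul_smul, Matrix.trace_smul, smul_eq_mul]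
    have h2 : (Q * Y t).trace = (P * Y t).trace -
        (P * ((A - inputMatrix A B * K) * Y t * (A - inputMatrix A B * K)ᵀ)).trace -
          ∑ τ : Fin (D + 1), q τ t := by
      rw [hQdef, Matrix.sub_mul, Matrix.trace_sub, trace_sum_dual, sum_closedLoop, Matrix.mul_add,
        Matrix.trace_add, Matrix.mul_sum, Matrix.trace_sum]
      simp only [hq, Matrix.mul_smul, Matrix.trace_smul, smul_eq_mul, hgu]
      ring
    rw [h1, h2, Finset.sum_sub_distrib]
    ring
  have hsum : ∀ T : ℕ, ∑ t ∈ Finset.range T, (Q * Y t).trace + (P * Y T).trace = (P * Y 0).trace +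
      ∑ τ : Fin (D + 1), (∑ t ∈ Finset.range T, q τ ((t : ℤ) - ((τ : ℕ) : ℤ)) -
        ∑ t ∈ Finset.range T, q τ t) := by
    intro T
    induction T with
    | zero => simp
    | succ T ih =>
      simp only [Finset.sum_range_succ, hstep T, Finset.sum_sub_distrib,
        Finset.sum_add_distrib] at ih ⊢
      linarith
  -- The terminal boundary sums and tr(P Y_T) are nonnegative and dropped; what remains depends on
  -- initial data alone.
  have hbound : ∀ T : ℕ, ∑ t ∈ Finset.range T, (Q * Y t).trace ≤ (P * Y 0).trace +
      ∑ τ : Fin (D + 1), ∑ j ∈ Finset.range τ, q τ ((j : ℤ) - ((τ : ℕ) : ℤ)) := by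
    intro T
    have h1 : ∑ τ : Fin (D + 1), (∑ t ∈ Finset.range T, q τ ((t : ℤ) - ((τ : ℕ) : ℤ)) -
        ∑ t ∈ Finset.range T, q τ t) ≤
        ∑ τ : Fin (D + 1), ∑ j ∈ Finset.range τ, q τ ((j : ℤ) - ((τ : ℕ) : ℤ)) := by
      refine Finset.sum_le_sum fun τ _ => ?_
      have h2 : 0 ≤ ∑ j ∈ Finset.range (τ : ℕ), q τ (((T + j : ℕ) : ℤ) - ((τ : ℕ) : ℤ)) :=
        Finset.sum_nonneg fun j _ => hq0 τ (T + j)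
      rw [sum_range_sub_natCast]
      linarith
    have h3 := trace_mul_nonneg hP.posSemidef (hYpsd T)
    linarith [hsum T]
  have hs := summable_of_sum_range_le
    (fun t => trace_mul_nonneg hQ.posSemidef (hYpsd t)) hbound
  obtain ⟨c, hc0, -, hc⟩ := exists_smul_le hQ (Matrix.PosSemidef.one (n := Fin n) (R := ℝ))
  refine Summable.of_nonneg_of_le (fun t => (hYpsd t).trace_nonneg) (fun t => ?_)
    (hs.mul_left c⁻¹)
  have h1 := trace_mul_nonneg hc (hYpsd t)
  rw [Matrix.sub_mul, Matrix.trace_sub, Matrix.smul_mul, Matrix.one_mul, Matrix.trace_smul,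
    smul_eq_mul] at h1
  rw [inv_mul_eq_div, le_div_iff₀ hc0]
  linarith

variable [IsProbabilityMeasure μ]

theorem stabilizable_of_lyapunov (hA : IsUnit A) (hω : IsNoise μ ω σ)
    {K : Matrix (Fin m) (Fin n) ℝ} {P : Matrix (Fin n) (Fin n) ℝ} (hP : P.PosDef)
    (hQ : (P - ∑ a, (closedLoop A B C σ K a)ᵀ * P * closedLoop A B C σ K a).PosDef) :
    MeanSquareStabilizable μ A B C ω := by
  -- These gains are u_t = -K y_t written out in x_t and the past controls.
  refine ⟨-(K * A ^ D), fun i => -(K * delayCoeff A B i), fun x₀ u₀ => ?_⟩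
  obtain ⟨x, u, hx0, hu0, hsol, hfb⟩ := exists_trajectory A B C ω (-(K * A ^ D))
    (fun i => -(K * delayCoeff A B i)) x₀ (fun k => if h : k < D then u₀ ⟨k, h⟩ else 0)
  have hfb' : ∀ (t : ℕ) (θ : Ω), u (t : ℤ) θ = (-K) *ᵥ predictor A B x u t θ := fun t θ => by
    rw [hfb, predictor, Matrix.mulVec_add, Matrix.mulVec_sum]
    simp only [Matrix.mulVec_mulVec, Matrix.neg_mul]
  -- Letting k range over all of ℕ closes the induction; controls before time -D were set to the
  -- constant 0.
  have hpast : ∀ t : ℕ, PastSqInt μ ω t (x t) ∧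
      ∀ k : ℕ, PastSqInt μ ω t (u ((t : ℤ) - ((k : ℤ) + 1))) := by
    intro t
    induction t with
    | zero =>
      refine ⟨?_, fun k => ?_⟩
      · rw [show x 0 = fun _ => x₀ from funext hx0]
        exact PastSqInt.const _ _
      · have h1 : u (((0 : ℕ) : ℤ) - ((k : ℤ) + 1)) =
            fun _ => if h : k < D then u₀ ⟨k, h⟩ else 0 := by
          funext θ
          rw [← hu0 k θ]; simp
        rw [h1]
        exact PastSqInt.const _ _
    | succ t ih =>
      have hut : PastSqInt μ ω t (u (t : ℤ)) := by
        rw [show u (t : ℤ) = _ from funext (hfb' t)]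
        exact (pastSqInt_predictor ih.1 fun i => ih.2 i).mulVec (-K)
      have hu : ∀ k : ℕ, PastSqInt μ ω t (u ((t : ℤ) - (k : ℤ))) := by
        rintro (_ | k)
        · simpa using hut
        · simpa using ih.2 k
      refine ⟨hsol.pastSqInt_succ hω ih.1 fun τ => hu τ, fun k => ?_⟩
      have h1 : ((t + 1 : ℕ) : ℤ) - ((k : ℤ) + 1) = (t : ℤ) - k := by push_cast; ring
      rw [h1]
      exact (hu k).mono t.le_succ
  have hy : ∀ t, PastSqInt μ ω t (predictor A B x u t) := fun t =>
    pastSqInt_predictor (hpast t).1 fun i => (hpast t).2 i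
  have hut : ∀ t : ℕ, PastSqInt μ ω t (u (t : ℤ)) := fun t => by
    rw [show u (t : ℤ) = _ from funext (hfb' t)]
    exact (hy t).mulVec (-K)
  have hu : ∀ t k : ℕ, PastSqInt μ ω t (u ((t : ℤ) - (k : ℤ))) := by
    rintro t (_ | k)
    · simpa using hut t
    · simpa using (hpast t).2 k
  have hsumY := summable_trace_gram_predictor hω hP hQ hsol (fun t τ => hu t τ) hy hfb'
  have hsumU : Summable fun t : ℕ => (gram μ (u (t : ℤ)) (u (t : ℤ))).trace := by
    refine Summable.of_nonneg_of_le (fun t => (posSemidef_gram_self (hut t).2).trace_nonneg)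
      (fun t => ?_) (hsumY.mul_left ((-K)ᵀ * (-K)).trace)
    rw [show u (t : ℤ) = _ from funext (hfb' t)]
    exact trace_gram_mulVec_le (hy t).2 (-K)
  have hnullU : ∀ k : ℕ, MeanSquareNull μ fun t : ℕ => u ((t : ℤ) - k) := fun k =>
    ⟨fun t => (hu t k).2, tendsto_sub_natCast (g := fun z => (gram μ (u z) (u z)).trace)
      hsumU.tendsto_atTop_zero k⟩
  have hnullX : MeanSquareNull μ x := by
    have h1 : MeanSquareNull μ (predictor A B x u) :=
      ⟨fun t => (hy t).2, hsumY.tendsto_atTop_zero⟩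
    have h2 := (h1.add (MeanSquareNull.sum (s := Finset.univ) (f := fun (i : Fin D) (t : ℕ) θ =>
      (-delayCoeff A B i) *ᵥ u ((t : ℤ) - (((i : ℕ) + 1 : ℕ) : ℤ)) θ)
      fun i _ => (hnullU (i + 1)).mulVec _)).mulVec (A ^ D)⁻¹
    convert h2 using 3 with t θ
    have hd : IsUnit (A ^ D).det := (Matrix.isUnit_iff_isUnit_det _).1 (hA.pow D)
    have h3 : predictor A B x u t θ + ∑ i : Fin D,
        (-delayCoeff A B i) *ᵥ u ((t : ℤ) - (((i : ℕ) + 1 : ℕ) : ℤ)) θ = A ^ D *ᵥ x t θ := by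
      simp only [predictor, Matrix.neg_mulVec, Finset.sum_neg_distrib, Nat.cast_add, Nat.cast_one,
        add_neg_cancel_right]
    rw [h3, Matrix.mulVec_mulVec, Matrix.nonsing_inv_mul _ hd, Matrix.one_mulVec]
  refine ⟨x, u, hx0, fun τ θ => ?_, hsol, ⟨hfb, fun t => ?_, fun t => ?_, ?_⟩, fun t => ?_, ?_⟩
  · rw [hu0, dif_pos τ.isLt]
  · exact @measurable_pi_lambda _ _ _ (past ω t) _ _ (hut t).1
  · exact (hut t).2.integrable_dotProduct
  · exact hsumU.congr fun t => trace_gram_self (hut t).2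
  · exact (hpast t).1.2.integrable_dotProduct
  · exact hnullX.2.congr fun t => trace_gram_self (hpast t).1.2

end Sufficiency

/-! ### Necessity: regression on stabilized trajectories -/

section Necessity

/-- Regressing the controls on the states: the second moments split into those of a static feedback
and a positive semidefinite remainder. -/
theorem exists_regression {n m : ℕ} {Ω : Type*} [MeasurableSpace Ω] {μ : Measure Ω} {α : Type*}
    {s : Finset α} {y : α → Ω → Fin n → ℝ} {u : α → Ω → Fin m → ℝ}
    (hy : ∀ a ∈ s, SqInt μ (y a)) (hu : ∀ a ∈ s, SqInt μ (u a))
    (hX : IsUnit (∑ a ∈ s, gram μ (y a) (y a)))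
    (A : Matrix (Fin n) (Fin n) ℝ) (L : Matrix (Fin n) (Fin m) ℝ) :
    ∃ (K : Matrix (Fin m) (Fin n) ℝ) (E : Matrix (Fin m) (Fin m) ℝ), E.PosSemidef ∧
      ∑ a ∈ s, gram μ (u a) (u a) = E + K * (∑ a ∈ s, gram μ (y a) (y a)) * Kᵀ ∧
      ∑ a ∈ s, gram μ (fun θ => A *ᵥ y a θ + L *ᵥ u a θ) (fun θ => A *ᵥ y a θ + L *ᵥ u a θ) =
        (A - L * K) * (∑ a ∈ s, gram μ (y a) (y a)) * (A - L * K)ᵀ + L * E * Lᵀ := by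
  set X := ∑ a ∈ s, gram μ (y a) (y a) with hXdef
  -- The normal equations: with this K the residual e = u + K y is orthogonal to y after summation
  -- over s, though not for each a.
  set K := -((∑ a ∈ s, gram μ (u a) (y a)) * X⁻¹) with hK
  set e : α → Ω → Fin m → ℝ := fun a θ => u a θ + K *ᵥ y a θ with he
  have hes : ∀ a ∈ s, SqInt μ (e a) := fun a ha => (hu a ha).add ((hy a ha).mulVec K)
  have hey : ∑ a ∈ s, gram μ (e a) (y a) = 0 := by
    have h1 : ∀ a ∈ s, gram μ (e a) (y a) = gram μ (u a) (y a) + K * gram μ (y a) (y a) :=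
      fun a ha => by
        rw [gram_add_left (hu a ha) ((hy a ha).mulVec K) (hy a ha),
          gram_mulVec_left (hy a ha) (hy a ha)]
    rw [Finset.sum_congr rfl h1, Finset.sum_add_distrib, ← Matrix.mul_sum, ← hXdef, hK,
      Matrix.neg_mul, Matrix.mul_assoc,
      Matrix.nonsing_inv_mul _ ((Matrix.isUnit_iff_isUnit_det _).1 hX), Matrix.mul_one,
      add_neg_cancel]
  have hye : ∑ a ∈ s, gram μ (y a) (e a) = 0 := by
    have h1 := congrArg Matrix.transpose hey
    rw [Matrix.transpose_sum, Matrix.transpose_zero] at h1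
    simpa only [gram_transpose] using h1
  have key : ∀ (p : ℕ) (M : Matrix (Fin p) (Fin n) ℝ) (N : Matrix (Fin p) (Fin m) ℝ),
      ∑ a ∈ s, gram μ (fun θ => M *ᵥ y a θ + N *ᵥ e a θ) (fun θ => M *ᵥ y a θ + N *ᵥ e a θ) =
        M * X * Mᵀ + N * (∑ a ∈ s, gram μ (e a) (e a)) * Nᵀ := by
    intro p M N
    have h1 : ∀ a ∈ s, gram μ (fun θ => M *ᵥ y a θ + N *ᵥ e a θ)
        (fun θ => M *ᵥ y a θ + N *ᵥ e a θ) = M * gram μ (y a) (y a) * Mᵀ +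
          N * gram μ (e a) (y a) * Mᵀ + M * gram μ (y a) (e a) * Nᵀ +
          N * gram μ (e a) (e a) * Nᵀ := fun a ha => by
      rw [gram_add_self ((hy a ha).mulVec M) ((hes a ha).mulVec N), gram_mulVec_mulVec (hy a ha),
        gram_mulVec_mulVec (hes a ha), gram_mulVec_left (hes a ha) ((hy a ha).mulVec M),
        gram_mulVec_right (hes a ha) (hy a ha), gram_mulVec_left (hy a ha) ((hes a ha).mulVec N),
        gram_mulVec_right (hy a ha) (hes a ha), Matrix.mul_assoc N, Matrix.mul_assoc M]
      simp only [Matrix.mul_assoc]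
    rw [Finset.sum_congr rfl h1]
    simp only [Finset.sum_add_distrib, ← Matrix.sum_mul, ← Matrix.mul_sum, hey, hye,
      Matrix.mul_zero, Matrix.zero_mul, add_zero, ← hXdef]
  refine ⟨K, ∑ a ∈ s, gram μ (e a) (e a),
    Matrix.posSemidef_sum s fun a ha => posSemidef_gram_self (hes a ha), ?_, ?_⟩
  · have h1 := key m (-K) 1
    have h2 : ∀ a, (fun θ => (-K) *ᵥ y a θ + (1 : Matrix (Fin m) (Fin m) ℝ) *ᵥ e a θ) = u a :=
      fun a => by
        funext θ
        simp only [he, Matrix.neg_mulVec, Matrix.one_mulVec]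
        abel
    simp only [h2] at h1
    rw [h1]
    simp only [Matrix.transpose_neg, Matrix.neg_mul, Matrix.mul_neg, neg_neg, Matrix.one_mul,
      Matrix.transpose_one, Matrix.mul_one]
    exact add_comm _ _
  · rw [← key n (A - L * K) L]
    refine Finset.sum_congr rfl fun a _ => ?_
    have h2 : (fun θ => A *ᵥ y a θ + L *ᵥ u a θ) =
        fun θ => (A - L * K) *ᵥ y a θ + L *ᵥ e a θ := by
      funext θ
      simp only [he, Matrix.sub_mulVec, Matrix.mulVec_add, Matrix.mulVec_mulVec]
      abel
    rw [h2]

variable {n m D : ℕ} {Ω : Type*} [MeasurableSpace Ω] {μ : Measure Ω} [IsProbabilityMeasure μ]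
  {ω : ℕ → Fin (D + 1) → Ω → ℝ} {σ : Fin (D + 1) → ℝ}
  {A : Matrix (Fin n) (Fin n) ℝ} {B C : Fin (D + 1) → Matrix (Fin n) (Fin m) ℝ}

theorem gram_const (v : Fin n → ℝ) :
    gram μ (fun _ : Ω => v) (fun _ : Ω => v) = Matrix.vecMulVec v v := by
  ext i j
  simp [gram, Matrix.vecMulVec_apply]

/-- A family of trajectories, one for every basis vector as initial predicted state, all tending to
zero in mean square. -/
theorem MeanSquareStabilizable.exists_trajectories (hA : IsUnit A) (hω : IsNoise μ ω σ)
    (h : MeanSquareStabilizable μ A B C ω) :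
    ∃ (x : Fin n → ℕ → Ω → Fin n → ℝ) (u : Fin n → ℤ → Ω → Fin m → ℝ),
      (∀ i, IsSolution A B C ω (x i) (u i)) ∧
      (∀ i θ, predictor A B (x i) (u i) 0 θ = Pi.single i 1) ∧
      (∀ i t, PastSqInt μ ω t (predictor A B (x i) (u i) t)) ∧
      (∀ i (t : ℕ) (τ : Fin (D + 1)), PastSqInt μ ω t (u i ((t : ℤ) - ((τ : ℕ) : ℤ)))) ∧
      (∀ i, MeanSquareNull μ (predictor A B (x i) (u i))) ∧
      ∀ i (τ : Fin (D + 1)), MeanSquareNull μ fun t : ℕ => u i ((t : ℤ) - ((τ : ℕ) : ℤ)) := by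
  obtain ⟨K₀, K, hK⟩ := h
  -- Zero past controls and x_0 = A^{-D} e_i make the initial predictor e_i.
  choose x u hx0 hu0 hsol hadm hxint hxlim using
    fun i : Fin n => hK ((A ^ D)⁻¹ *ᵥ Pi.single i 1) 0
  have hut : ∀ i (t : ℕ), PastSqInt μ ω t (u i (t : ℤ)) := fun i t => by
    have hm : Measurable (u i (t : ℤ)) := ((hadm i).adapted t).mono (hω.past_le t) le_rfl
    exact ⟨fun j => (measurable_pi_apply j).comp ((hadm i).adapted t),
      SqInt.of_integrable hm ((hadm i).integrable t)⟩
  have hu : ∀ i (t : ℕ) (τ : Fin (D + 1)), PastSqInt μ ω t (u i ((t : ℤ) - ((τ : ℕ) : ℤ))) := by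
    intro i t τ
    rcases le_or_gt (τ : ℕ) t with hle | hlt
    · rw [← Nat.cast_sub hle]
      exact (hut i _).mono (Nat.sub_le _ _)
    · have hτ := τ.isLt
      have h1 : u i ((t : ℤ) - ((τ : ℕ) : ℤ)) = fun _ => 0 := by
        funext θ
        have h2 := hu0 i ⟨(τ : ℕ) - t - 1, by omega⟩ θ
        have h3 : -((((τ : ℕ) - t - 1 : ℕ) : ℤ) + 1) = (t : ℤ) - ((τ : ℕ) : ℤ) := by omega
        simp only [h3] at h2
        exact h2
      rw [h1]
      exact PastSqInt.const _ _
  have hx : ∀ i t, PastSqInt μ ω t (x i t) := by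
    intro i t
    induction t with
    | zero =>
      rw [show x i 0 = _ from funext (hx0 i)]
      exact PastSqInt.const _ _
    | succ t ih => exact (hsol i).pastSqInt_succ hω ih (hu i t)
  have hud : ∀ i (t : ℕ) (τ : Fin D), PastSqInt μ ω t (u i ((t : ℤ) - (((τ : ℕ) : ℤ) + 1))) :=
    fun i t τ => by simpa using hu i t τ.succ
  have hnullU : ∀ i (τ : Fin (D + 1)), MeanSquareNull μ
      fun t : ℕ => u i ((t : ℤ) - ((τ : ℕ) : ℤ)) := fun i τ => by
    refine ⟨fun t => (hu i t τ).2, tendsto_sub_natCast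
      (g := fun z => (gram μ (u i z) (u i z)).trace) ?_ τ⟩
    exact (hadm i).summable.tendsto_atTop_zero.congr fun t => (trace_gram_self (hut i t).2).symm
  have hnullX : ∀ i, MeanSquareNull μ (x i) := fun i =>
    ⟨fun t => (hx i t).2, (hxlim i).congr fun t => (trace_gram_self (hx i t).2).symm⟩
  refine ⟨x, u, hsol, fun i θ => ?_, fun i t => pastSqInt_predictor (hx i t) (hud i t), hu,
    fun i => ?_, hnullU⟩
  · have hd : IsUnit (A ^ D).det := (Matrix.isUnit_iff_isUnit_det _).1 (hA.pow D)
    have h1 : ∀ τ : Fin D, u i (((0 : ℕ) : ℤ) - (((τ : ℕ) : ℤ) + 1)) θ = 0 := fun τ => by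
      rw [Nat.cast_zero, zero_sub, hu0]; rfl
    simp only [predictor, h1, hx0, Matrix.mulVec_zero, Finset.sum_const_zero, add_zero,
      Matrix.mulVec_mulVec, Matrix.mul_nonsing_inv _ hd, Matrix.one_mulVec]
  · refine ((hnullX i).mulVec (A ^ D)).add (MeanSquareNull.sum
      (f := fun (τ : Fin D) (t : ℕ) θ => delayCoeff A B τ *ᵥ u i ((t : ℤ) - (((τ : ℕ) : ℤ) + 1)) θ)
      fun τ _ => ?_)
    have h1 := (hnullU i τ.succ).mulVec (delayCoeff A B τ)
    simpa using h1

theorem lyapunov_of_stabilizable (hA : IsUnit A) (hω : IsNoise μ ω σ)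
    (h : MeanSquareStabilizable μ A B C ω) :
    ∃ (K : Matrix (Fin m) (Fin n) ℝ) (P : Matrix (Fin n) (Fin n) ℝ), P.PosDef ∧
      (P - ∑ a, (closedLoop A B C σ K a)ᵀ * P * closedLoop A B C σ K a).PosDef := by
  obtain ⟨x, u, hsol, hy0, hy, hu, hnullY, hnullU⟩ := h.exists_trajectories hA hω
  set y := fun i => predictor A B (x i) (u i) with hydef
  set G : Fin (D + 1) → Matrix (Fin n) (Fin m) ℝ := fun τ => A ^ D * C τ with hG
  set Y : ℕ → Matrix (Fin n) (Fin n) ℝ := fun t => ∑ i, gram μ (y i t) (y i t) with hY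
  set U : ℤ → Matrix (Fin m) (Fin m) ℝ := fun z => ∑ i, gram μ (u i z) (u i z) with hU
  have hYpsd : ∀ t, (Y t).PosSemidef := fun t =>
    Matrix.posSemidef_sum _ fun i _ => posSemidef_gram_self (hy i t).2
  have hUpsd : ∀ (t : ℕ) (τ : Fin (D + 1)), (U ((t : ℤ) - ((τ : ℕ) : ℤ))).PosSemidef := fun t τ =>
    Matrix.posSemidef_sum _ fun i _ => posSemidef_gram_self (hu i t τ).2
  have hY0 : Y 0 = 1 := by
    have h1 : ∀ i, gram μ (y i 0) (y i 0) = Matrix.vecMulVec (Pi.single i 1) (Pi.single i 1) :=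
      fun i => by rw [show y i 0 = _ from funext (hy0 i), gram_const]
    ext j k
    simp only [hY, h1, Matrix.sum_apply, Matrix.vecMulVec_apply, Pi.single_apply, Matrix.one_apply]
    simp
  -- The terminal leftover at time T: Y_T plus the moments of the last controls, which have not yet
  -- acted through the delayed channels.
  set R : ℕ → Matrix (Fin n) (Fin n) ℝ := fun T => Y T + ∑ τ : Fin (D + 1), σ τ ^ 2 • (G τ *
    (∑ j ∈ Finset.range τ, U (((T + j : ℕ) : ℤ) - ((τ : ℕ) : ℤ))) * (G τ)ᵀ) with hR
  have hRpsd : ∀ T, (R T).PosSemidef := fun T => (hYpsd T).add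
    (Matrix.posSemidef_sum _ fun τ _ => (posSemidef_conj
      (Matrix.posSemidef_sum _ fun j _ => hUpsd (T + j) τ) _).smul (sq_nonneg _))
  have hGU : ∀ (τ : Fin (D + 1)) (j : ℕ), Tendsto (fun T : ℕ =>
      (G τ * U (((T + j : ℕ) : ℤ) - ((τ : ℕ) : ℤ)) * (G τ)ᵀ).trace) atTop (𝓝 0) := by
    intro τ j
    have h1 : ∀ T : ℕ, (G τ * U (((T + j : ℕ) : ℤ) - ((τ : ℕ) : ℤ)) * (G τ)ᵀ).trace =
        ∑ i, (gram μ (fun θ => G τ *ᵥ u i (((T + j : ℕ) : ℤ) - ((τ : ℕ) : ℤ)) θ)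
          (fun θ => G τ *ᵥ u i (((T + j : ℕ) : ℤ) - ((τ : ℕ) : ℤ)) θ)).trace := fun T => by
      rw [hU, Matrix.mul_sum, Matrix.sum_mul, Matrix.trace_sum]
      exact Finset.sum_congr rfl fun i _ => by rw [gram_mulVec_mulVec (hu i (T + j) τ).2]
    simp only [h1]
    have h2 : ∀ i ∈ Finset.univ, Tendsto (fun T : ℕ =>
        (gram μ (fun θ => G τ *ᵥ u i (((T + j : ℕ) : ℤ) - ((τ : ℕ) : ℤ)) θ)
          (fun θ => G τ *ᵥ u i (((T + j : ℕ) : ℤ) - ((τ : ℕ) : ℤ)) θ)).trace) atTop (𝓝 0) :=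
      fun i _ => (tendsto_add_atTop_iff_nat j).2 ((hnullU i τ).mulVec (G τ)).2
    simpa using tendsto_finsetSum _ h2
  have hRlim : Tendsto (fun T => (R T).trace) atTop (𝓝 0) := by
    have h1 : Tendsto (fun T => (Y T).trace) atTop (𝓝 0) := by
      simp only [hY, Matrix.trace_sum]
      simpa using tendsto_finsetSum Finset.univ fun i _ => (hnullY i).2
    have h2 : Tendsto (fun T => ∑ τ : Fin (D + 1), σ τ ^ 2 * ∑ j ∈ Finset.range (τ : ℕ),
        (G τ * U (((T + j : ℕ) : ℤ) - ((τ : ℕ) : ℤ)) * (G τ)ᵀ).trace) atTop (𝓝 0) := by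
      simpa using tendsto_finsetSum Finset.univ fun (τ : Fin (D + 1)) _ =>
        (tendsto_finsetSum (Finset.range (τ : ℕ)) fun j _ => hGU τ j).const_mul (σ τ ^ 2)
    have h3 := h1.add h2
    rw [add_zero] at h3
    refine h3.congr fun T => ?_
    simp only [hR, Matrix.trace_add, Matrix.trace_sum, Matrix.trace_smul, smul_eq_mul,
      Matrix.mul_sum, Matrix.sum_mul]
  obtain ⟨T, hT1, hT0⟩ :=
    ((hRlim.eventually_lt_const one_pos).and (eventually_gt_atTop 0)).exists
  have hX : (∑ t ∈ Finset.range T, Y t).PosDef := by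
    obtain ⟨k, rfl⟩ := Nat.exists_eq_succ_of_ne_zero hT0.ne'
    rw [Finset.sum_range_succ', hY0]
    exact Matrix.PosDef.posSemidef_add (Matrix.posSemidef_sum _ fun t _ => hYpsd _)
      Matrix.PosDef.one
  set X := ∑ t ∈ Finset.range T, Y t with hXdef
  have hXp : ∑ p ∈ Finset.range T ×ˢ (Finset.univ : Finset (Fin n)),
      gram μ (y p.2 p.1) (y p.2 p.1) = X := Finset.sum_product _ _ _
  -- One regression pools all times t < T and all n trajectories, so K depends on neither.
  obtain ⟨K, E, hE, hUE, hdrift⟩ := exists_regression (μ := μ)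
    (s := Finset.range T ×ˢ (Finset.univ : Finset (Fin n))) (y := fun p => y p.2 p.1)
    (u := fun p => u p.2 (p.1 : ℤ)) (fun p _ => (hy p.2 p.1).2)
    (fun p _ => by simpa using (hu p.2 p.1 0).2) (by rw [hXp]; exact hX.isUnit) A (inputMatrix A B)
  rw [hXp, Finset.sum_product] at hUE hdrift
  have hstep : ∀ t : ℕ, Y (t + 1) = ∑ i,
      gram μ (fun θ => A *ᵥ y i t θ + inputMatrix A B *ᵥ u i (t : ℤ) θ)
        (fun θ => A *ᵥ y i t θ + inputMatrix A B *ᵥ u i (t : ℤ) θ) +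
      ∑ τ : Fin (D + 1), σ τ ^ 2 • (G τ * U ((t : ℤ) - ((τ : ℕ) : ℤ)) * (G τ)ᵀ) := fun t => by
    simp only [hY, hU, Matrix.mul_sum, Matrix.sum_mul, Finset.smul_sum]
    rw [Finset.sum_comm, ← Finset.sum_add_distrib]
    exact Finset.sum_congr rfl fun i _ => (hsol i).gram_predictor_succ hω (hy i t) (hu i t)
  set pre : Fin (D + 1) → Matrix (Fin m) (Fin m) ℝ := fun τ =>
    ∑ j ∈ Finset.range (τ : ℕ), U ((j : ℤ) - ((τ : ℕ) : ℤ)) with hpre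
  have hUsum : ∑ t ∈ Finset.range T, U t = E + K * X * Kᵀ := hUE
  -- Summing the moment recursion over t < T and using Y_0 = 1. The residual E and the initial
  -- controls only add positive semidefinite terms, so tr R(T) < 1 suffices for positive
  -- definiteness.
  have hmain : X - ∑ a, closedLoop A B C σ K a * X * (closedLoop A B C σ K a)ᵀ =
      (1 - R T) + (inputMatrix A B * E * (inputMatrix A B)ᵀ +
        ∑ τ : Fin (D + 1), σ τ ^ 2 • (G τ * (E + pre τ) * (G τ)ᵀ)) := by
    have h1 : ∑ t ∈ Finset.range T, Y (t + 1) + Y 0 = X + Y T := by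
      rw [← Finset.sum_range_succ', Finset.sum_range_succ]
    have h2 : ∑ t ∈ Finset.range T, Y (t + 1) =
        ((A - inputMatrix A B * K) * X * (A - inputMatrix A B * K)ᵀ +
          inputMatrix A B * E * (inputMatrix A B)ᵀ) +
        ∑ τ : Fin (D + 1), σ τ ^ 2 • (G τ * (pre τ + (E + K * X * Kᵀ) -
          ∑ j ∈ Finset.range τ, U (((T + j : ℕ) : ℤ) - ((τ : ℕ) : ℤ))) * (G τ)ᵀ) := by
      simp only [hstep]
      rw [Finset.sum_add_distrib, hdrift, Finset.sum_comm]
      congr 1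
      refine Finset.sum_congr rfl fun τ _ => ?_
      rw [← hUsum, ← sum_range_sub_natCast, Matrix.mul_sum, Matrix.sum_mul, Finset.smul_sum]
    rw [hY0, h2] at h1
    rw [sum_closedLoop, hR]
    simp only [Matrix.mul_add, Matrix.add_mul, Matrix.mul_sub, Matrix.sub_mul, smul_add, smul_sub,
      Finset.sum_add_distrib, Finset.sum_sub_distrib] at h1 ⊢
    rw [← sub_eq_zero] at h1 ⊢
    rw [← neg_eq_zero, ← h1]
    abel
  refine ⟨K, exists_posDef_of_dual (closedLoop A B C σ K) hX ?_⟩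
  rw [hmain]
  refine (posDef_one_sub_of_trace_lt_one (hRpsd T) hT1).add_posSemidef
    ((posSemidef_conj hE _).add (Matrix.posSemidef_sum _ fun τ _ =>
      (posSemidef_conj (hE.add (Matrix.posSemidef_sum _ fun j _ => hUpsd j τ)) _).smul
        (sq_nonneg _)))

end Necessity

end MultiDelay

theorem corollary1 {n m D : ℕ} {Ω : Type*} [MeasurableSpace Ω]
    (μ : MeasureTheory.Measure Ω) [MeasureTheory.IsProbabilityMeasure μ]
    (A : Matrix (Fin n) (Fin n) ℝ) (hA : IsUnit A)
    (B C : Fin (D + 1) → Matrix (Fin n) (Fin m) ℝ)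
    (ω : ℕ → Fin (D + 1) → Ω → ℝ) (σ : Fin (D + 1) → ℝ) (hω : MultiDelay.IsNoise μ ω σ) :
    (MultiDelay.MeanSquareStabilizable μ A B C ω ↔
      ∃ (Y : Matrix (Fin m) (Fin n) ℝ) (S : Matrix (Fin n) (Fin n) ℝ),
        MultiDelay.NegDef S ∧ MultiDelay.NegDef (MultiDelay.lmiMatrix A B C σ Y S)) ∧
    ∀ (K : Matrix (Fin m) (Fin n) ℝ) (P : Matrix (Fin n) (Fin n) ℝ), P.PosDef →
      (MultiDelay.NegDef (MultiDelay.lmiMatrix A B C σ (K * P⁻¹) (-P⁻¹)) ↔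
        (P - ((A - MultiDelay.inputMatrix A B * K)ᵀ * P * (A - MultiDelay.inputMatrix A B * K) +
          ∑ τ : Fin (D + 1),
            σ τ ^ 2 • (Kᵀ * (C τ)ᵀ * (Aᵀ) ^ D * P * A ^ D * C τ * K))).PosDef) := by
  refine ⟨?_, fun K P hP => ?_⟩
  · rw [MultiDelay.exists_lmi_iff]
    exact ⟨MultiDelay.lyapunov_of_stabilizable hA hω,
      fun ⟨_, _, hP, hQ⟩ => MultiDelay.stabilizable_of_lyapunov hA hω hP hQ⟩
  · rw [MultiDelay.negDef_lmiMatrix_iff A B C σ K hP, MultiDelay.sum_closedLoop_dual]
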